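/- Let $K$ be a field and $k\ge 1$. A *$k$-graph* is a small category $\Lambda$ with a functor $d:\Lambda\to\mathbb N^k$ (the degree) such that every morphism ("path") $\lambda$ with $d(\lambda)=m+n$ has a unique factorisation $\lambda=\mu\circ\nu$ with $d(\mu)=m$, $d(\nu)=n$. Objects are called vertices, and $s(\lambda),r(\lambda)$ denote source and range. For a vertex $v$, let $\Lambda v$ and $v\Lambda$ be the sets of paths with source $v$ and with range $v$, respectively, and let $v\Lambda^n=\{\lambda\in v\Lambda: d(\lambda)=n\}$. All $k$-graphs are assumed nonempty, connected, row-finite (all $v\Lambda^n$ are finite) and without sources (all $v\Lambda^n$ are nonempty). A morphism of $k$-graphs is a degree-preserving functor. A *covering* of $\Delta$ is a morphism $\tau:\Omega\to\Delta$ that maps $\Omega v$ bijectively onto $\Delta\tau(v)$ and $v\Omega$ bijectively onto $\tau(v)\Delta$ for every vertex $v$ of $\Omega$. It is *universal* if for every covering $\beta:\Sigma\to\Delta$ there is a morphism $\phi:\Omega\to\Sigma$ with $\beta\circ\phi=\tau$. The *fundamental group* $\pi(\Lambda,y)$ is the automorphism group of the vertex $y$ in the groupoid obtained from $\Lambda$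 by formally inverting all morphisms. The *Kumjian-Pask algebra* $\mathrm{KP}(\Lambda)$ is the associative, not necessarily unital, $K$-algebra generated by the paths $\lambda$ and symbols $\lambda^*$ (where $\lambda^*=\lambda$ if $d(\lambda)=0$) subject to the following relations: for all paths $\lambda,\mu$, $\lambda\mu=\lambda\circ\mu$ and $\mu^*\lambda^*=(\lambda\circ\mu)^*$ if $s(\lambda)=r(\mu)$, and both products are $0$ otherwise; for all $\lambda,\mu$ with $d(\lambda)=d(\mu)$, $\lambda^*\mu=\delta_{\lambda,\mu}1_{s(\lambda)}$; and $\sum_{\lambda\in v\Lambda^n}\lambda\lambda^*=1_v$ for all vertices $v$ and all $n\in\mathbb N^k$. A *representation $k$-graph* for $\Lambda$ is a pair $(\Delta,\alpha)$ of a $k$-graph $\Delta$ and a morphism $\alpha:\Delta\to\Lambda$ that maps $\Delta v$ bijectively onto $\Lambda\alpha(v)$ for every vertex $v$ of $\Delta$, and such that each $v\Delta^n$ is a singleton. These are the objects of a category $\mathrm{RG}(\Lambda)$, whose morphisms are the $k$-graph morphisms over $\Lambda$. Let $V_{(\Delta,\alpha)}$ be the $K$-vector space with basis the vertices of $\Delta$,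 with the left $\mathrm{KP}(\Lambda)$-module structure in which, for a vertex $v$, $\lambda\cdot v=r(\delta)$ if there is a (necessarily unique) $\delta\in\Delta v$ with $\alpha(\delta)=\lambda$, and $\lambda\cdot v=0$ otherwise; and $\lambda^*\cdot v=s(\delta)$ if there is a (necessarily unique) $\delta\in v\Delta$ with $\alpha(\delta)=\lambda$, and $\lambda^*\cdot v=0$ otherwise. A *walk* in $\Delta$ is a nonempty finite composable sequence of paths and formally reversed non-identity paths of $\Delta$; $\alpha$ maps walks in $\Delta$ to walks in $\Lambda$. For vertices $u,v$ of $\Delta$ write $u\sim v$ if the walks starting at $u$ and the walks starting at $v$ have the same set of images under $\alpha$. For paths $\delta,\delta'$ of $\Delta$ write $\delta\sim\delta'$ if $s(\delta)\sim s(\delta')$ and $\alpha(\delta)=\alpha(\delta')$. Then $\Delta/{\sim}$, whose vertices and paths are the classes of vertices and paths of $\Delta$, is a $k$-graph with $s([\delta])=[s(\delta)]$, $r([\delta])=[r(\delta)]$, $d([\delta])=d(\delta)$ and $[\delta]\circ[\delta']=[\delta\circ\delta']$ for composable $\delta,\delta'$, and together with the morphism induced by $\alpha$ it is a representation $k$-graph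 for $\Lambda$. **Theorem.** Let $\Lambda$ be a $k$-graph and $C$ a connected component of $\mathrm{RG}(\Lambda)$. Choose any object $(\Delta,\alpha)$ of $C$ and any universal covering $\tau:\Omega\to\Delta$; put $(\Omega_C,\zeta_C)=(\Omega,\alpha\circ\tau)$, which is again a representation $k$-graph for $\Lambda$, and let $(\Gamma_C,\xi_C)$ be its quotient by $\sim$. Let $y$ be a vertex of $\Gamma_C$ and $G=\pi(\Gamma_C,y)$. Then the $\mathrm{KP}(\Lambda)$-module $V_{(\Omega_C,\zeta_C)}$ is indecomposable (i.e. it is nonzero and is not the direct sum of two nonzero submodules) if and only if the group algebra $KG$ has no nontrivial idempotents, i.e. no idempotents other than $0$ and $1$. -/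

import Mathlib

open CategoryTheory

universe u

noncomputable section

/-- A `k`-graph: a small category with a degree functor to `ℕ^k` satisfying the unique
factorisation property. As standing assumptions, a `k`-graph is nonempty and connected
(`IsConnected` comprises both), row-finite, and has no sources.
A morphism `f : a ⟶ b` is a path with source `a` and range `b`; the composite of paths that is
written `f ∘ g` in the literature is `g ≫ f` here. -/
structure KGraph (k : ℕ) : Type (u + 1) where
  Ob : Type u
  [cat : SmallCategory Ob]
  deg : ∀ {a b : Ob}, (a ⟶ b) → (Fin k → ℕ)
  deg_id : ∀ a : Ob, deg (𝟙 a) = 0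
  deg_comp : ∀ {a b c : Ob} (f : a ⟶ b) (g : b ⟶ c), deg (f ≫ g) = deg f + deg g
  factorisation : ∀ {a b : Ob} (f : a ⟶ b) (m n : Fin k → ℕ), deg f = m + n →
    ∃! p : Σ c : Ob, (a ⟶ c) × (c ⟶ b), deg p.2.2 = m ∧ deg p.2.1 = n ∧ p.2.1 ≫ p.2.2 = f
  connected : CategoryTheory.IsConnected Ob
  rowFinite : ∀ (v : Ob) (n : Fin k → ℕ),
    {f : Quiver.Total Ob | f.right = v ∧ deg f.hom = n}.Finite
  noSources : ∀ (v : Ob) (n : Fin k → ℕ),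
    {f : Quiver.Total Ob | f.right = v ∧ deg f.hom = n}.Nonempty

attribute [instance] KGraph.cat

namespace KGraph

variable {k : ℕ}

/-- The set of all paths (morphisms) of a `k`-graph; for a path `f`, `f.left` is the source `s(f)`
and `f.right` is the range `r(f)`. -/
abbrev Path (Λ : KGraph.{u} k) : Type u := Quiver.Total Λ.Ob

/-- The degree of a path. -/
def pathDeg (Λ : KGraph.{u} k) (f : Λ.Path) : Fin k → ℕ := Λ.deg f.hom

/-- The identity path at a vertex. -/
def idPath (Λ : KGraph.{u} k) (v : Λ.Ob) : Λ.Path := ⟨v, v, 𝟙 v⟩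

/-- The path "first `f`, then `g`", for composable paths `f` and `g`. -/
def compPath {Λ : KGraph.{u} k} (f g : Λ.Path) (h : f.right = g.left) : Λ.Path :=
  ⟨f.left, g.right, f.hom ≫ eqToHom h ≫ g.hom⟩

/-- `Λv`, the set of paths with source `v`. -/
def pathsFrom (Λ : KGraph.{u} k) (v : Λ.Ob) : Set Λ.Path := {f | f.left = v}

/-- `vΛ`, the set of paths with range `v`. -/
def pathsTo (Λ : KGraph.{u} k) (v : Λ.Ob) : Set Λ.Path := {f | f.right = v}

/-- `vΛⁿ`, the set of paths of degree `n` with range `v`. -/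
def pathsToDeg (Λ : KGraph.{u} k) (v : Λ.Ob) (n : Fin k → ℕ) : Set Λ.Path :=
  {f | f.right = v ∧ Λ.pathDeg f = n}

theorem pathsToDeg_finite (Λ : KGraph.{u} k) (v : Λ.Ob) (n : Fin k → ℕ) :
    (Λ.pathsToDeg v n).Finite := Λ.rowFinite v n

theorem pathDeg_idPath (Λ : KGraph.{u} k) (v : Λ.Ob) : Λ.pathDeg (Λ.idPath v) = 0 :=
  Λ.deg_id v

theorem deg_eqToHom (Λ : KGraph.{u} k) {a b : Λ.Ob} (h : a = b) : Λ.deg (eqToHom h) = 0 := by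
  subst h; exact Λ.deg_id _

theorem pathDeg_compPath {Λ : KGraph.{u} k} (f g : Λ.Path) (h : f.right = g.left) :
    Λ.pathDeg (compPath f g h) = Λ.pathDeg f + Λ.pathDeg g := by
  simp [pathDeg, compPath, deg_comp, deg_eqToHom]

theorem compPath_congr {Λ : KGraph.{u} k} {f g f' g' : Λ.Path} (hf : f = f') (hg : g = g')
    (h : f.right = g.left) (h' : f'.right = g'.left) : compPath f g h = compPath f' g' h' := by
  subst hf hg; rfl

theorem compPath_mk {Λ : KGraph.{u} k} {a b c : Λ.Ob} (f : a ⟶ b) (g : b ⟶ c) :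
    compPath (⟨a, b, f⟩ : Λ.Path) ⟨b, c, g⟩ rfl = ⟨a, c, f ≫ g⟩ := by
  simp [compPath]

theorem compPath_assoc {Λ : KGraph.{u} k} (f g h : Λ.Path) (h₁ : f.right = g.left)
    (h₂ : g.right = h.left) :
    compPath (compPath f g h₁) h h₂ = compPath f (compPath g h h₂) h₁ := by
  obtain ⟨a, b, f⟩ := f
  obtain ⟨b', c, g⟩ := g
  obtain ⟨c', d, h⟩ := h
  dsimp at h₁ h₂
  subst h₁ h₂
  simp [compPath]

theorem idPath_compPath {Λ : KGraph.{u} k} (f : Λ.Path) :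
    compPath (Λ.idPath f.left) f rfl = f := by
  simp [compPath, idPath]

theorem compPath_idPath {Λ : KGraph.{u} k} (f : Λ.Path) :
    compPath f (Λ.idPath f.right) rfl = f := by
  simp [compPath, idPath]

theorem eq_idPath_of_pathDeg {Λ : KGraph.{u} k} (f : Λ.Path) (h : Λ.pathDeg f = 0) :
    f = Λ.idPath f.left := by
  obtain ⟨a, b, f⟩ := f
  have h0 : Λ.deg f = 0 := h
  have H := (Λ.factorisation f 0 0 (by simpa using h0)).unique
    (y₁ := ⟨b, f, 𝟙 b⟩) (y₂ := ⟨a, 𝟙 a, f⟩)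
    ⟨Λ.deg_id b, h0, Category.comp_id f⟩ ⟨h0, Λ.deg_id a, Category.id_comp f⟩
  obtain ⟨h1, h2⟩ := Sigma.mk.inj_iff.1 H
  subst h1
  have h3 := (Prod.mk.injEq _ _ _ _).mp (eq_of_heq h2)
  simp [idPath, h3.1]

/-- Uniqueness of factorisations, for paths. -/
theorem compPath_unique {Λ : KGraph.{u} k} {f g f' g' : Λ.Path} (h : f.right = g.left)
    (h' : f'.right = g'.left) (e : compPath f g h = compPath f' g' h')
    (df : Λ.pathDeg f = Λ.pathDeg f') (dg : Λ.pathDeg g = Λ.pathDeg g') : f = f' ∧ g = g' := by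
  obtain ⟨a, b, f⟩ := f
  obtain ⟨b', c, g⟩ := g
  obtain ⟨a', d, f'⟩ := f'
  obtain ⟨d', c', g'⟩ := g'
  dsimp at h h'
  subst h h'
  rw [compPath_mk, compPath_mk] at e
  obtain ⟨rfl, rfl, e⟩ := (Quiver.Total.mk.injEq ..).mp e
  have e := eq_of_heq e
  have H := (Λ.factorisation (f ≫ g) (Λ.deg g) (Λ.deg f)
    (by rw [Λ.deg_comp, add_comm])).unique
    (y₁ := ⟨b, f, g⟩) (y₂ := ⟨d, f', g'⟩) ⟨rfl, rfl, rfl⟩ ⟨dg.symm, df.symm, e.symm⟩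
  obtain ⟨h1, h2⟩ := Sigma.mk.inj_iff.1 H
  subst h1
  have h3 := (Prod.mk.injEq _ _ _ _).mp (eq_of_heq h2)
  simp [h3.1, h3.2]

/-- A morphism of `k`-graphs: a degree-preserving functor. -/
structure Hom (Λ Δ : KGraph.{u} k) : Type u where
  toFunctor : Λ.Ob ⥤ Δ.Ob
  deg_map : ∀ {a b : Λ.Ob} (f : a ⟶ b), Δ.deg (toFunctor.map f) = Λ.deg f

namespace Hom

variable {Λ Δ Ω : KGraph.{u} k}

/-- The map on vertices. -/
def onOb (φ : Hom Λ Δ) (v : Λ.Ob) : Δ.Ob := φ.toFunctor.obj v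

/-- The map on paths. -/
def onPath (φ : Hom Λ Δ) (f : Λ.Path) : Δ.Path :=
  ⟨φ.toFunctor.obj f.left, φ.toFunctor.obj f.right, φ.toFunctor.map f.hom⟩

/-- The identity morphism. -/
def id (Λ : KGraph.{u} k) : Hom Λ Λ := ⟨𝟭 _, fun _ => rfl⟩

/-- The composite "first `φ`, then `ψ`". -/
def comp (φ : Hom Λ Δ) (ψ : Hom Δ Ω) : Hom Λ Ω :=
  ⟨φ.toFunctor ⋙ ψ.toFunctor, fun f => (ψ.deg_map _).trans (φ.deg_map f)⟩

theorem pathDeg_onPath (φ : Hom Λ Δ) (f : Λ.Path) : Δ.pathDeg (φ.onPath f) = Λ.pathDeg f :=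
  φ.deg_map f.hom

theorem onPath_idPath (φ : Hom Λ Δ) (v : Λ.Ob) :
    φ.onPath (Λ.idPath v) = Δ.idPath (φ.onOb v) := by
  simp [onPath, idPath, onOb]

theorem onPath_compPath (φ : Hom Λ Δ) (f g : Λ.Path) (h : f.right = g.left) :
    φ.onPath (compPath f g h) =
      compPath (φ.onPath f) (φ.onPath g) (congrArg φ.toFunctor.obj h) := by
  simp [onPath, compPath, eqToHom_map]

end Hom

/-- A covering of a `k`-graph: a morphism that restricts to bijections `Ωv → Λτ(v)` and
`vΩ → τ(v)Λ` for every vertex `v`. -/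
def IsCovering {Ω Λ : KGraph.{u} k} (τ : Hom Ω Λ) : Prop :=
  ∀ v : Ω.Ob, Set.BijOn τ.onPath (Ω.pathsFrom v) (Λ.pathsFrom (τ.onOb v)) ∧
    Set.BijOn τ.onPath (Ω.pathsTo v) (Λ.pathsTo (τ.onOb v))

/-- A universal covering: a covering with a morphism of coverings to every covering. -/
def IsUniversalCovering {Ω Λ : KGraph.{u} k} (τ : Hom Ω Λ) : Prop :=
  IsCovering τ ∧ ∀ (S : KGraph.{u} k) (β : Hom S Λ), IsCovering β →
    ∃ φ : Hom Ω S, φ.comp β = τ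

/-- The fundamental group of a `k`-graph at a vertex: the group of automorphisms of the vertex in
the fundamental groupoid, that is, in the universal groupoid on the category. -/
abbrev FundamentalGroup (Λ : KGraph.{u} k) (x : Λ.Ob) : Type u := End (FreeGroupoid.mk x)

/-- A path is an identity morphism. -/
def IsIdPath (Λ : KGraph.{u} k) (f : Λ.Path) : Prop := ∃ v, f = Λ.idPath v

/-- The edges of the doubled underlying graph: every path `f` is an edge, and every path `f` which
is not an identity has in addition a reversed edge `f*`. -/
inductive Edge (Λ : KGraph.{u} k) : Type u
  | fwd (f : Λ.Path) : Edge Λ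
  | rev (f : Λ.Path) (hf : ¬ Λ.IsIdPath f) : Edge Λ

/-- The source of an edge. -/
def Edge.src {Λ : KGraph.{u} k} : Λ.Edge → Λ.Ob
  | .fwd f => f.left
  | .rev f _ => f.right

/-- The range of an edge. -/
def Edge.tgt {Λ : KGraph.{u} k} : Λ.Edge → Λ.Ob
  | .fwd f => f.right
  | .rev f _ => f.left

/-- The edges of the list `e₁, e₂, …` are composable, in this order of travel, and the first one
(if there is any) starts at `v`. -/
def ChainFrom (Λ : KGraph.{u} k) : Λ.Ob → List Λ.Edge → Prop
  | _, [] => True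
  | v, e :: l => e.src = v ∧ ChainFrom Λ e.tgt l

/-- `Walk_v(Λ)`: the walks starting at `v`, i.e. the nonempty finite sequences of composable edges
starting at `v`, listed in the order of travel. -/
def walksFrom (Λ : KGraph.{u} k) (v : Λ.Ob) : Set (List Λ.Edge) :=
  {p | p ≠ [] ∧ Λ.ChainFrom v p}

theorem Hom.isIdPath_of_onPath {Λ Δ : KGraph.{u} k} (φ : Hom Λ Δ) {f : Λ.Path}
    (h : Δ.IsIdPath (φ.onPath f)) : Λ.IsIdPath f := by
  obtain ⟨v, hv⟩ := h
  refine ⟨f.left, eq_idPath_of_pathDeg f ?_⟩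
  rw [← φ.pathDeg_onPath, hv, pathDeg_idPath]

/-- The map induced by a morphism on edges. -/
def Hom.onEdge {Λ Δ : KGraph.{u} k} (φ : Hom Λ Δ) : Λ.Edge → Δ.Edge
  | .fwd f => .fwd (φ.onPath f)
  | .rev f hf => .rev (φ.onPath f) fun h => hf (φ.isIdPath_of_onPath h)

/-- The map induced by a morphism on walks. -/
def Hom.onWalk {Λ Δ : KGraph.{u} k} (φ : Hom Λ Δ) (p : List Λ.Edge) : List Δ.Edge :=
  p.map φ.onEdge

end KGraph

/-- A representation `k`-graph for `Λ`: a `k`-graph `Δ` with a morphism `α : Δ → Λ` which maps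
`Δv` bijectively onto `Λα(v)`, and such that every `vΔⁿ` is a singleton. -/
structure RepKGraph {k : ℕ} (Λ : KGraph.{u} k) : Type (u + 1) where
  graph : KGraph.{u} k
  hom : KGraph.Hom graph Λ
  bijOn_from : ∀ v : graph.Ob,
    Set.BijOn hom.onPath (graph.pathsFrom v) (Λ.pathsFrom (hom.onOb v))
  existsUnique_to : ∀ (v : graph.Ob) (n : Fin k → ℕ), ∃! f, f ∈ graph.pathsToDeg v n

namespace RepKGraph

open KGraph

variable {k : ℕ} {Λ : KGraph.{u} k}

/-- A morphism of representation `k`-graphs: a morphism of `k`-graphs over `Λ`. -/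
structure Hom (X Y : RepKGraph Λ) : Type u where
  map : KGraph.Hom X.graph Y.graph
  comm : map.comp Y.hom = X.hom

/-- The category `RG(Λ)` of representation `k`-graphs for `Λ`. -/
instance : Category.{u} (RepKGraph Λ) where
  Hom := Hom
  id X := ⟨KGraph.Hom.id X.graph, rfl⟩
  comp φ ψ := ⟨φ.map.comp ψ.map, by
    rw [← φ.comm, ← ψ.comm]; rfl⟩

/-- If `(Δ, α)` is a representation `k`-graph for `Λ` and `(Ω, τ)` is a covering of `Δ`, then
`(Ω, α ∘ τ)` is a representation `k`-graph for `Λ`. -/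
def ofCovering (X : RepKGraph Λ) {Ω : KGraph.{u} k} (τ : KGraph.Hom Ω X.graph)
    (hτ : IsCovering τ) : RepKGraph Λ where
  graph := Ω
  hom := τ.comp X.hom
  bijOn_from v := (X.bijOn_from (τ.onOb v)).comp (hτ v).1
  existsUnique_to v n := by
    obtain ⟨g, ⟨hg, hgn⟩, hu⟩ := X.existsUnique_to (τ.onOb v) n
    obtain ⟨f, hf, rfl⟩ := (hτ v).2.surjOn hg
    refine ⟨f, ⟨hf, by rw [← hgn, τ.pathDeg_onPath]⟩, ?_⟩
    rintro f' ⟨hf', hn'⟩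
    refine (hτ v).2.injOn hf' hf (hu _ ⟨(hτ v).2.mapsTo hf', ?_⟩)
    rw [τ.pathDeg_onPath, hn']

end RepKGraph

namespace RepKGraph

open KGraph

variable {k : ℕ} {Λ : KGraph.{u} k}

/-- The set `α(Walk_v(Δ))` of walks in `Λ`. -/
def walkImage (X : RepKGraph Λ) (v : X.graph.Ob) : Set (List Λ.Edge) :=
  X.hom.onWalk '' X.graph.walksFrom v

/-- The equivalence relation `∼` on the vertices of `Δ`:
`u ∼ v` if and only if `α(Walk_u(Δ)) = α(Walk_v(Δ))`. -/
def obSetoid (X : RepKGraph Λ) : Setoid X.graph.Ob where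
  r u v := X.walkImage u = X.walkImage v
  iseqv := ⟨fun _ => rfl, fun h => h.symm, fun h h' => h.trans h'⟩

/-- The equivalence relation `∼` on the paths of `Δ`:
`f ∼ g` if and only if `s(f) ∼ s(g)` and `α(f) = α(g)`. -/
def pathSetoid (X : RepKGraph Λ) : Setoid X.graph.Path where
  r f g := X.obSetoid f.left g.left ∧ X.hom.onPath f = X.hom.onPath g
  iseqv := ⟨fun _ => ⟨X.obSetoid.refl _, rfl⟩, fun h => ⟨X.obSetoid.symm h.1, h.2.symm⟩,
    fun h h' => ⟨X.obSetoid.trans h.1 h'.1, h.2.trans h'.2⟩⟩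

section lemmas

variable (X : RepKGraph Λ)

theorem path_eq_of_left {f g : X.graph.Path} (h : f.left = g.left)
    (e : X.hom.onPath f = X.hom.onPath g) : f = g :=
  (X.bijOn_from g.left).injOn h rfl e

theorem path_eq_of_right {f g : X.graph.Path} (h : f.right = g.right)
    (e : X.hom.onPath f = X.hom.onPath g) : f = g :=
  (X.existsUnique_to g.right (X.graph.pathDeg g)).unique
    ⟨h, by rw [← X.hom.pathDeg_onPath, e, X.hom.pathDeg_onPath]⟩ ⟨rfl, rfl⟩

theorem edge_eq {d e : X.graph.Edge} (h : d.src = e.src)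
    (he : X.hom.onEdge d = X.hom.onEdge e) : d = e := by
  cases d <;> cases e <;> simp only [KGraph.Hom.onEdge, Edge.fwd.injEq, Edge.rev.injEq,
    reduceCtorEq] at he ⊢
  · exact X.path_eq_of_left h he
  · exact X.path_eq_of_right h he

theorem exists_edge {u v : X.graph.Ob} (h : X.obSetoid u v) (e : X.graph.Edge)
    (he : e.src = u) : ∃ e' : X.graph.Edge, e'.src = v ∧ X.hom.onEdge e' = X.hom.onEdge e := by
  have h : X.walkImage u = X.walkImage v := h
  have h1 : X.hom.onWalk [e] ∈ X.walkImage u := ⟨[e], ⟨by simp, he, trivial⟩, rfl⟩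
  rw [h] at h1
  obtain ⟨p, ⟨hp0, hp⟩, hpe⟩ := h1
  cases p with
  | nil => exact absurd rfl hp0
  | cons e' l =>
    simp only [KGraph.Hom.onWalk, List.map_cons, List.map_nil, List.cons.injEq] at hpe
    exact ⟨e', hp.1, hpe.1⟩

theorem tgt_rel_aux {u v : X.graph.Ob} (h : X.obSetoid u v) (e e' : X.graph.Edge)
    (he : e.src = u) (he' : e'.src = v) (hee : X.hom.onEdge e = X.hom.onEdge e') :
    X.walkImage e.tgt ⊆ X.walkImage e'.tgt := by
  rintro _ ⟨p, ⟨hp0, hp⟩, rfl⟩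
  have h : X.walkImage u = X.walkImage v := h
  have h1 : X.hom.onWalk (e :: p) ∈ X.walkImage u := ⟨e :: p, ⟨by simp, he, hp⟩, rfl⟩
  rw [h] at h1
  obtain ⟨q, ⟨hq0, hq⟩, hqe⟩ := h1
  cases q with
  | nil => exact absurd rfl hq0
  | cons d l =>
    simp only [KGraph.Hom.onWalk, List.map_cons, List.cons.injEq] at hqe
    obtain rfl : d = e' := X.edge_eq (hq.1.trans he'.symm) (hqe.1.trans hee)
    refine ⟨l, ⟨?_, hq.2⟩, hqe.2⟩
    rintro rfl
    exact hp0 (List.map_eq_nil_iff.1 hqe.2.symm)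

theorem tgt_rel {u v : X.graph.Ob} (h : X.obSetoid u v) (e e' : X.graph.Edge)
    (he : e.src = u) (he' : e'.src = v) (hee : X.hom.onEdge e = X.hom.onEdge e') :
    X.obSetoid e.tgt e'.tgt :=
  (X.tgt_rel_aux h e e' he he' hee).antisymm
    (X.tgt_rel_aux (X.obSetoid.symm h) e' e he' he hee.symm)

theorem obSetoid_onOb {u v : X.graph.Ob} (h : X.obSetoid u v) : X.hom.onOb u = X.hom.onOb v := by
  obtain ⟨e', h1, h2⟩ := X.exists_edge h (.fwd (X.graph.idPath u)) rfl
  cases e' with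
  | fwd f =>
    simp only [KGraph.Hom.onEdge, Edge.fwd.injEq] at h2
    have := congrArg Quiver.Total.left h2
    rw [← h1]
    exact this.symm
  | rev f hf => simp [KGraph.Hom.onEdge] at h2

theorem exists_path_from {u v : X.graph.Ob} (h : X.obSetoid u v) (f : X.graph.Path)
    (hf : f.left = u) : ∃ g : X.graph.Path, g.left = v ∧ X.hom.onPath g = X.hom.onPath f := by
  obtain ⟨e', h1, h2⟩ := X.exists_edge h (.fwd f) hf
  cases e' with
  | fwd g =>
    simp only [KGraph.Hom.onEdge, Edge.fwd.injEq] at h2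
    exact ⟨g, h1, h2⟩
  | rev f hf => simp [KGraph.Hom.onEdge] at h2

theorem pathSetoid_right {f g : X.graph.Path} (h : X.pathSetoid f g) :
    X.obSetoid f.right g.right :=
  X.tgt_rel h.1 (.fwd f) (.fwd g) rfl rfl (congrArg Edge.fwd h.2)

theorem exists_path_to {u v : X.graph.Ob} (h : X.obSetoid u v) (f : X.graph.Path)
    (hf : f.right = u) : ∃ g : X.graph.Path, g.right = v ∧ X.pathSetoid g f := by
  by_cases hid : X.graph.IsIdPath f
  · obtain ⟨w, rfl⟩ := hid
    obtain rfl : w = u := hf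
    refine ⟨X.graph.idPath v, rfl, X.obSetoid.symm h, ?_⟩
    rw [X.hom.onPath_idPath, X.hom.onPath_idPath, X.obSetoid_onOb h]
  · obtain ⟨e', h1, h2⟩ := X.exists_edge h (.rev f hid) hf
    cases e' with
    | fwd g => simp [KGraph.Hom.onEdge] at h2
    | rev g hg =>
      refine ⟨g, h1, X.tgt_rel (X.obSetoid.symm h) (.rev g hg) (.rev f hid) h1 hf h2, ?_⟩
      simpa only [KGraph.Hom.onEdge, Edge.rev.injEq] using h2

end lemmas

/-- The vertices of the quotient of `Δ` by `∼`. -/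
def QOb (X : RepKGraph Λ) : Type u := Quotient X.obSetoid

/-- The paths of the quotient of `Δ` by `∼`. -/
def QPath (X : RepKGraph Λ) : Type u := Quotient X.pathSetoid

section quotient

variable (X : RepKGraph Λ)

/-- The class of a vertex. -/
def qOb (v : X.graph.Ob) : X.QOb := Quotient.mk _ v

/-- The class of a path. -/
def qPath (f : X.graph.Path) : X.QPath := Quotient.mk _ f

theorem qOb_eq {u v : X.graph.Ob} : X.qOb u = X.qOb v ↔ X.obSetoid u v := Quotient.eq

theorem qPath_eq {f g : X.graph.Path} : X.qPath f = X.qPath g ↔ X.pathSetoid f g := Quotient.eq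

variable {X}

/-- `s([f]) = [s(f)]`. -/
def QPath.src (m : X.QPath) : X.QOb :=
  Quotient.lift (fun f => X.qOb f.left) (fun f g (h : X.pathSetoid f g) => X.qOb_eq.2 h.1) m

/-- `r([f]) = [r(f)]`. -/
def QPath.tgt (m : X.QPath) : X.QOb :=
  Quotient.lift (fun f => X.qOb f.right) (fun _ _ h => X.qOb_eq.2 (X.pathSetoid_right h)) m

/-- `[f] ↦ α(f)`. -/
def QPath.label (m : X.QPath) : Λ.Path :=
  Quotient.lift (fun f => X.hom.onPath f)
    (fun f g (h : X.pathSetoid f g) => h.2) m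

/-- `[v] ↦ α(v)`. -/
def QOb.label (A : X.QOb) : Λ.Ob :=
  Quotient.lift (fun v => X.hom.onOb v) (fun _ _ h => X.obSetoid_onOb h) A

/-- `d([f]) = d(f)`. -/
def QPath.deg (m : X.QPath) : Fin k → ℕ :=
  Quotient.lift (fun f => X.graph.pathDeg f)
    (fun f g (h : X.pathSetoid f g) => by
      rw [← X.hom.pathDeg_onPath, h.2, X.hom.pathDeg_onPath]) m

/-- `1_[v] = [1_v]`. -/
def QOb.idPath (A : X.QOb) : X.QPath :=
  Quotient.lift (fun v => X.qPath (X.graph.idPath v))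
    (fun u v h => X.qPath_eq.2 ⟨h, by
      rw [X.hom.onPath_idPath, X.hom.onPath_idPath, X.obSetoid_onOb h]⟩) A

theorem QOb.exists_rep (A : X.QOb) : ∃ v, X.qOb v = A := Quotient.exists_rep A

theorem QPath.exists_rep (m : X.QPath) : ∃ f, X.qPath f = m := Quotient.exists_rep m

theorem QPath.exists_rep_from (m : X.QPath) (v : X.graph.Ob) (h : m.src = X.qOb v) :
    ∃ f, f.left = v ∧ X.qPath f = m := by
  obtain ⟨f, rfl⟩ := m.exists_rep
  have h := X.qOb_eq.1 h
  obtain ⟨g, hg, hgf⟩ := X.exists_path_from h f rfl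
  exact ⟨g, hg, X.qPath_eq.2 ⟨by rw [hg]; exact X.obSetoid.symm h, hgf⟩⟩

theorem QPath.exists_rep_to (m : X.QPath) (v : X.graph.Ob) (h : m.tgt = X.qOb v) :
    ∃ f, f.right = v ∧ X.qPath f = m := by
  obtain ⟨f, rfl⟩ := m.exists_rep
  obtain ⟨g, hg, hgf⟩ := X.exists_path_to (X.qOb_eq.1 h) f rfl
  exact ⟨g, hg, X.qPath_eq.2 hgf⟩

theorem QPath.exists_comp (m n : X.QPath) (h : m.tgt = n.src) :
    ∃ p : X.QPath, ∃ (f g : X.graph.Path) (hfg : f.right = g.left),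
      X.qPath f = m ∧ X.qPath g = n ∧ p = X.qPath (compPath f g hfg) := by
  obtain ⟨f, rfl⟩ := m.exists_rep
  obtain ⟨g, hg, rfl⟩ := n.exists_rep_from f.right h.symm
  exact ⟨_, f, g, hg.symm, rfl, rfl, rfl⟩

/-- The composite "first `m`, then `n`" of two composable classes of paths: the class of the
composite of any composable representatives (see `QPath.comp_mk`). -/
def QPath.comp (m n : X.QPath) (h : m.tgt = n.src) : X.QPath :=
  (QPath.exists_comp m n h).choose

theorem QPath.comp_mk (f g : X.graph.Path) (hfg : f.right = g.left)
    (h : (X.qPath f).tgt = (X.qPath g).src) :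
    QPath.comp (X.qPath f) (X.qPath g) h = X.qPath (compPath f g hfg) := by
  obtain ⟨f', g', hfg', hf, hg, hp⟩ := (QPath.exists_comp (X.qPath f) (X.qPath g) h).choose_spec
  rw [QPath.comp, hp, qPath_eq]
  rw [qPath_eq] at hf hg
  refine ⟨hf.1, ?_⟩
  rw [X.hom.onPath_compPath, X.hom.onPath_compPath]
  exact compPath_congr hf.2 hg.2 _ _

theorem QPath.comp_src (m n : X.QPath) (h : m.tgt = n.src) : (m.comp n h).src = m.src := by
  obtain ⟨f, rfl⟩ := m.exists_rep
  obtain ⟨g, hg, rfl⟩ := n.exists_rep_from f.right h.symm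
  rw [QPath.comp_mk f g hg.symm]
  rfl

theorem QPath.comp_tgt (m n : X.QPath) (h : m.tgt = n.src) : (m.comp n h).tgt = n.tgt := by
  obtain ⟨f, rfl⟩ := m.exists_rep
  obtain ⟨g, hg, rfl⟩ := n.exists_rep_from f.right h.symm
  rw [QPath.comp_mk f g hg.symm]
  rfl

theorem QPath.comp_deg (m n : X.QPath) (h : m.tgt = n.src) :
    (m.comp n h).deg = m.deg + n.deg := by
  obtain ⟨f, rfl⟩ := m.exists_rep
  obtain ⟨g, hg, rfl⟩ := n.exists_rep_from f.right h.symm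
  rw [QPath.comp_mk f g hg.symm]
  exact pathDeg_compPath f g _

theorem QPath.comp_assoc (m n p : X.QPath) (h : m.tgt = n.src) (h' : n.tgt = p.src) :
    (m.comp n h).comp p ((m.comp_tgt n h).trans h') =
      m.comp (n.comp p h') (h.trans (n.comp_src p h').symm) := by
  obtain ⟨f, rfl⟩ := m.exists_rep
  obtain ⟨g, hg, rfl⟩ := n.exists_rep_from f.right h.symm
  obtain ⟨l, hl, rfl⟩ := p.exists_rep_from g.right h'.symm
  have e1 := QPath.comp_mk f g hg.symm h
  have e2 := QPath.comp_mk g l hl.symm h'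
  have e3 := QPath.comp_mk (compPath f g hg.symm) l hl.symm
    (by rw [← e1, QPath.comp_tgt]; exact h')
  have e4 := QPath.comp_mk f (compPath g l hl.symm) hg.symm
    (by rw [← e2, QPath.comp_src]; exact h)
  simp only [e1, e2, e3, e4]
  rw [compPath_assoc]

theorem QOb.idPath_src (A : X.QOb) : A.idPath.src = A := by
  obtain ⟨v, rfl⟩ := A.exists_rep; rfl

theorem QOb.idPath_tgt (A : X.QOb) : A.idPath.tgt = A := by
  obtain ⟨v, rfl⟩ := A.exists_rep; rfl

theorem QPath.id_comp (m : X.QPath) (A : X.QOb) (h : A = m.src) :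
    A.idPath.comp m (A.idPath_tgt.trans h) = m := by
  subst h
  obtain ⟨f, rfl⟩ := m.exists_rep
  exact (QPath.comp_mk (X.graph.idPath f.left) f rfl _).trans (by rw [idPath_compPath])

theorem QPath.comp_id (m : X.QPath) (A : X.QOb) (h : m.tgt = A) :
    m.comp A.idPath (h.trans A.idPath_src.symm) = m := by
  subst h
  obtain ⟨f, rfl⟩ := m.exists_rep
  exact (QPath.comp_mk f (X.graph.idPath f.right) rfl _).trans (by rw [compPath_idPath])

theorem QPath.label_left (m : X.QPath) : m.label.left = m.src.label := by
  obtain ⟨f, rfl⟩ := m.exists_rep; rfl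

theorem QPath.label_right (m : X.QPath) : m.label.right = m.tgt.label := by
  obtain ⟨f, rfl⟩ := m.exists_rep; rfl

theorem QPath.pathDeg_label (m : X.QPath) : Λ.pathDeg m.label = m.deg := by
  obtain ⟨f, rfl⟩ := m.exists_rep; exact X.hom.pathDeg_onPath f

variable (X)

/-- A morphism from `A` to `B` in the quotient: a class of paths with source `A` and range `B`. -/
@[ext]
structure QHom (A B : X.QOb) : Type u where
  path : X.QPath
  src_eq : path.src = A
  tgt_eq : path.tgt = B

/-- The quotient of `Δ` by `∼` as a category. -/
instance : SmallCategory X.QOb where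
  Hom A B := QHom X A B
  id A := ⟨A.idPath, A.idPath_src, A.idPath_tgt⟩
  comp m n := ⟨m.path.comp n.path (m.tgt_eq.trans n.src_eq.symm),
    (m.path.comp_src _ _).trans m.src_eq, (m.path.comp_tgt _ _).trans n.tgt_eq⟩
  id_comp m := QHom.ext (m.path.id_comp _ m.src_eq.symm)
  comp_id m := QHom.ext (m.path.comp_id _ m.tgt_eq)
  assoc m n p := QHom.ext (QPath.comp_assoc m.path n.path p.path
    (m.tgt_eq.trans n.src_eq.symm) (n.tgt_eq.trans p.src_eq.symm))

variable {X} in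
/-- The morphism of the quotient given by a class of paths. -/
def QHom.of {A B : X.QOb} (m : X.QPath) (h : m.src = A) (h' : m.tgt = B) : A ⟶ B :=
  QHom.mk m h h'

/-- The projection from `Δ` to its quotient by `∼`, as a functor. -/
def qFunctor : X.graph.Ob ⥤ X.QOb where
  obj v := X.qOb v
  map f := QHom.of (X.qPath ⟨_, _, f⟩) rfl rfl
  map_id _ := rfl
  map_comp f g := QHom.ext (by
    have h := QPath.comp_mk (X := X) ⟨_, _, f⟩ ⟨_, _, g⟩ rfl rfl
    rw [compPath_mk] at h
    exact h.symm)

variable {X}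

/-- The class of paths underlying a morphism of the quotient category. -/
def QPath.ofHom {A B : X.QOb} (f : A ⟶ B) : X.QPath := QHom.path f

theorem QPath.ofHom_src {A B : X.QOb} (f : A ⟶ B) : (QPath.ofHom f).src = A := QHom.src_eq f

theorem QPath.ofHom_tgt {A B : X.QOb} (f : A ⟶ B) : (QPath.ofHom f).tgt = B := QHom.tgt_eq f

theorem QPath.hom_cases {A B : X.QOb} (f : A ⟶ B) : ∃ m h h', f = QHom.of m h h' :=
  ⟨QHom.path f, QHom.src_eq f, QHom.tgt_eq f, rfl⟩

theorem QPath.total_ext {f g : Quiver.Total X.QOb}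
    (h : QPath.ofHom f.hom = QPath.ofHom g.hom) : f = g := by
  obtain ⟨A, B, f⟩ := f
  obtain ⟨A', B', g⟩ := g
  obtain ⟨m, rfl, rfl, rfl⟩ := QPath.hom_cases f
  obtain ⟨m', rfl, rfl, rfl⟩ := QPath.hom_cases g
  obtain rfl : m = m' := h
  rfl

theorem QPath.existsUnique_to (A : X.QOb) (n : Fin k → ℕ) :
    ∃! f : Quiver.Total X.QOb, f.right = A ∧ QPath.deg (QPath.ofHom f.hom) = n := by
  obtain ⟨v, rfl⟩ := A.exists_rep
  obtain ⟨f, ⟨hf, hn⟩, hu⟩ := X.existsUnique_to v n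
  subst hf
  refine ⟨⟨X.qOb f.left, X.qOb f.right, QHom.of (X.qPath f) rfl rfl⟩, ⟨rfl, hn⟩, ?_⟩
  rintro g ⟨hg, hgn⟩
  apply QPath.total_ext
  obtain ⟨g', hg', e⟩ := (QPath.ofHom g.hom).exists_rep_to f.right
    ((QPath.ofHom_tgt g.hom).trans hg)
  rw [← e]
  refine congrArg X.qPath (hu g' ⟨hg', ?_⟩)
  change (X.qPath g').deg = n
  rw [e]; exact hgn

theorem QPath.factorisation {A B : X.QOb} (f : A ⟶ B) (m n : Fin k → ℕ)
    (h : QPath.deg (QPath.ofHom f) = m + n) :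
    ∃! p : Σ C : X.QOb, (A ⟶ C) × (C ⟶ B),
      QPath.deg (QPath.ofHom p.2.2) = m ∧ QPath.deg (QPath.ofHom p.2.1) = n ∧
        p.2.1 ≫ p.2.2 = f := by
  obtain ⟨f, rfl, rfl, rfl⟩ := QPath.hom_cases f
  obtain ⟨⟨a, b, f⟩, rfl⟩ := f.exists_rep
  obtain ⟨⟨c, g, g'⟩, ⟨h1, h2, h3⟩, -⟩ := X.graph.factorisation f m n h
  dsimp at h1 h2 h3
  refine ⟨⟨X.qOb c, X.qFunctor.map g, X.qFunctor.map g'⟩, ⟨h1, h2, ?_⟩, ?_⟩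
  · have := (X.qFunctor.map_comp g g').symm
    rw [h3] at this
    exact this
  · rintro ⟨C, p, q⟩ ⟨d1, d2, e⟩
    obtain ⟨p, hp, rfl, rfl⟩ := QPath.hom_cases p
    obtain ⟨q, hq, hq', rfl⟩ := QPath.hom_cases q
    obtain ⟨p, hpa, rfl⟩ := p.exists_rep_from a hp
    obtain ⟨q, hqa, rfl⟩ := q.exists_rep_from p.right hq
    have e' : (X.qPath p).comp (X.qPath q) hq.symm = X.qPath ⟨a, b, f⟩ := congrArg QPath.ofHom e
    rw [QPath.comp_mk p q hqa.symm, qPath_eq] at e'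
    have e2 := X.path_eq_of_left (f := compPath p q hqa.symm) (g := ⟨a, b, f⟩) hpa e'.2
    rw [← h3, ← compPath_mk] at e2
    obtain ⟨rfl, rfl⟩ := compPath_unique _ _ e2 (d2.trans h2.symm) (d1.trans h1.symm)
    rfl

variable (X)

theorem qOb_isConnected : CategoryTheory.IsConnected X.QOb := by
  have := X.graph.connected
  obtain ⟨v⟩ := this.is_nonempty
  have : Nonempty X.QOb := ⟨X.qOb v⟩
  refine zigzag_isConnected fun A B => ?_
  obtain ⟨a, rfl⟩ := A.exists_rep
  obtain ⟨b, rfl⟩ := B.exists_rep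
  exact zigzag_obj_of_zigzag X.qFunctor (isPreconnected_zigzag a b)

/-- The quotient `k`-graph of `Δ` by `∼`. -/
def quotientGraph : KGraph.{u} k where
  Ob := X.QOb
  deg f := QPath.deg (QPath.ofHom f)
  deg_id A := by
    obtain ⟨v, rfl⟩ := A.exists_rep
    exact X.graph.deg_id v
  deg_comp f g := QPath.comp_deg (QPath.ofHom f) (QPath.ofHom g)
    ((QPath.ofHom_tgt f).trans (QPath.ofHom_src g).symm)
  factorisation := QPath.factorisation
  connected := X.qOb_isConnected
  rowFinite A n := by
    obtain ⟨f, -, hu⟩ := QPath.existsUnique_to A n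
    exact (Set.finite_singleton f).subset fun g hg => hu g hg
  noSources A n := (QPath.existsUnique_to A n).exists

/-- The action on morphisms of `quotientFunctor`: `[f] ↦ α(f)`. -/
def quotientMap {A B : X.QOb} (f : A ⟶ B) : A.label ⟶ B.label :=
  eqToHom (by rw [QPath.label_left, QPath.ofHom_src]) ≫ (QPath.ofHom f).label.hom ≫
    eqToHom (by rw [QPath.label_right, QPath.ofHom_tgt])

theorem quotientMap_qFunctor {a b : X.graph.Ob} (f : a ⟶ b) :
    X.quotientMap (X.qFunctor.map f) = X.hom.toFunctor.map f := by
  change 𝟙 _ ≫ X.hom.toFunctor.map f ≫ 𝟙 _ = _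
  rw [Category.comp_id]
  exact Category.id_comp _

theorem mk_quotientMap {A B : X.QOb} (f : A ⟶ B) :
    (⟨A.label, B.label, X.quotientMap f⟩ : Λ.Path) = (QPath.ofHom f).label := by
  obtain ⟨f, rfl, rfl, rfl⟩ := QPath.hom_cases f
  obtain ⟨⟨a, b, f⟩, rfl⟩ := f.exists_rep
  exact congrArg (Quiver.Total.mk _ _) (X.quotientMap_qFunctor f)

/-- The functor from the quotient of `Δ` by `∼` to `Λ` induced by `α`: it maps `[v]` to `α(v)` and
`[f]` to `α(f)`. -/
def quotientFunctor : X.QOb ⥤ Λ.Ob where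
  obj A := A.label
  map f := X.quotientMap f
  map_id A := by
    obtain ⟨v, rfl⟩ := A.exists_rep
    exact (X.quotientMap_qFunctor (𝟙 v)).trans (X.hom.toFunctor.map_id v)
  map_comp f g := by
    obtain ⟨f, rfl, rfl, rfl⟩ := QPath.hom_cases f
    obtain ⟨g, hg, rfl, rfl⟩ := QPath.hom_cases g
    obtain ⟨⟨a, b, f⟩, rfl⟩ := f.exists_rep
    obtain ⟨⟨b', c, g⟩, hb, rfl⟩ := g.exists_rep_from b hg
    dsimp at hb
    subst hb
    have e : X.quotientMap (X.qFunctor.map f ≫ X.qFunctor.map g) =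
        X.quotientMap (X.qFunctor.map f) ≫ X.quotientMap (X.qFunctor.map g) := by
      rw [← X.qFunctor.map_comp, quotientMap_qFunctor, quotientMap_qFunctor,
        quotientMap_qFunctor, X.hom.toFunctor.map_comp]
      rfl
    exact e

/-- The morphism `α_∼` from the quotient of `Δ` by `∼` to `Λ`. -/
def quotientHom : KGraph.Hom X.quotientGraph Λ where
  toFunctor := X.quotientFunctor
  deg_map f := (congrArg Λ.pathDeg (X.mk_quotientMap f)).trans (QPath.pathDeg_label _)

theorem quotientHom_onPath (f : X.quotientGraph.Path) :
    X.quotientHom.onPath f = (QPath.ofHom f.hom).label := X.mk_quotientMap f.hom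

/-- The quotient representation `k`-graph `(Δ_∼, α_∼)`. -/
def quotient : RepKGraph Λ where
  graph := X.quotientGraph
  hom := X.quotientHom
  bijOn_from A := by
    obtain ⟨v, rfl⟩ := QOb.exists_rep A
    refine ⟨?_, ?_, ?_⟩
    · intro f hf
      exact congrArg X.quotientHom.onOb hf
    · intro f hf g hg e
      rw [quotientHom_onPath, quotientHom_onPath] at e
      refine QPath.total_ext ?_
      obtain ⟨f', hf', ef⟩ := (QPath.ofHom f.hom).exists_rep_from v ((QPath.ofHom_src _).trans hf)
      obtain ⟨g', hg', eg⟩ := (QPath.ofHom g.hom).exists_rep_from v ((QPath.ofHom_src _).trans hg)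
      rw [← ef, ← eg] at e ⊢
      exact congrArg X.qPath (X.path_eq_of_left (hf'.trans hg'.symm) e)
    · intro g hg
      obtain ⟨f, hf, rfl⟩ := (X.bijOn_from v).surjOn hg
      refine ⟨⟨X.qOb f.left, X.qOb f.right, QHom.of (X.qPath f) rfl rfl⟩,
        congrArg X.qOb hf, ?_⟩
      rw [quotientHom_onPath]
      rfl
  existsUnique_to A n := QPath.existsUnique_to A n

end quotient

end RepKGraph

namespace KGraph

variable {k : ℕ}

/-- The generators of the Kumjian-Pask algebra: the paths `f`, and a symbol `f*` for each path `f`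
of nonzero degree. -/
inductive KPGen (Λ : KGraph.{u} k) : Type u
  | path (f : Λ.Path) : KPGen Λ
  | ghost (f : Λ.Path) (hf : Λ.pathDeg f ≠ 0) : KPGen Λ

open Classical in
/-- The generator `f*`, where `f* = f` if `f` has degree zero. -/
def KPGen.star {Λ : KGraph.{u} k} (f : Λ.Path) : Λ.KPGen :=
  if hf : Λ.pathDeg f = 0 then .path f else .ghost f hf

/-- The free associative (non-unital) `K`-algebra on the generators. -/
abbrev KPFree (K : Type*) [Field K] (Λ : KGraph.{u} k) : Type _ :=
  MonoidAlgebra K (FreeSemigroup Λ.KPGen)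

section

variable (K : Type*) [Field K] (Λ : KGraph.{u} k)

variable {Λ} in
/-- A generator as an element of the free algebra. -/
def kpGen (x : Λ.KPGen) : KPFree K Λ := MonoidAlgebra.single (FreeSemigroup.of x) 1

variable {Λ} in
/-- The element `f` of the free algebra. -/
def kpPath (f : Λ.Path) : KPFree K Λ := kpGen K (.path f)

variable {Λ} in
/-- The element `f*` of the free algebra. -/
def kpStar (f : Λ.Path) : KPFree K Λ := kpGen K (KPGen.star f)

/-- The defining relations of the Kumjian-Pask algebra. -/
inductive KPRelation : KPFree K Λ → KPFree K Λ → Prop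
  | kp1 (f g : Λ.Path) (h : g.right = f.left) :
      KPRelation (kpPath K f * kpPath K g) (kpPath K (compPath g f h))
  | kp1_zero (f g : Λ.Path) (h : g.right ≠ f.left) :
      KPRelation (kpPath K f * kpPath K g) 0
  | kp2 (f g : Λ.Path) (h : g.right = f.left) :
      KPRelation (kpStar K g * kpStar K f) (kpStar K (compPath g f h))
  | kp2_zero (f g : Λ.Path) (h : g.right ≠ f.left) :
      KPRelation (kpStar K g * kpStar K f) 0
  | kp3 (f : Λ.Path) :
      KPRelation (kpStar K f * kpPath K f) (kpPath K (Λ.idPath f.left))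
  | kp3_zero (f g : Λ.Path) (hd : Λ.pathDeg f = Λ.pathDeg g) (h : f ≠ g) :
      KPRelation (kpStar K f * kpPath K g) 0
  | kp4 (v : Λ.Ob) (n : Fin k → ℕ) :
      KPRelation (∑ f ∈ (Λ.pathsToDeg_finite v n).toFinset, kpPath K f * kpStar K f)
        (kpPath K (Λ.idPath v))

/-- The closure of the defining relations under the operations of a `K`-algebra; the equivalence
relation it generates is the congruence generated by the defining relations. -/
inductive KPCon : KPFree K Λ → KPFree K Λ → Prop
  | of {a b : KPFree K Λ} : KPRelation K Λ a b → KPCon a b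
  | smul (t : K) {a b : KPFree K Λ} : KPCon a b → KPCon (t • a) (t • b)
  | add_right {a b : KPFree K Λ} (c : KPFree K Λ) : KPCon a b → KPCon (a + c) (b + c)
  | mul_left (c : KPFree K Λ) {a b : KPFree K Λ} : KPCon a b → KPCon (c * a) (c * b)
  | mul_right {a b : KPFree K Λ} (c : KPFree K Λ) : KPCon a b → KPCon (a * c) (b * c)

/-- The Kumjian-Pask algebra `KP(Λ)`: the associative (non-unital) `K`-algebra presented by the
generators `KPGen` and the relations `KPRelation`. -/
def KP : Type _ := Quot (KPCon K Λ)

end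

namespace KP

variable {K : Type*} [Field K] {Λ : KGraph.{u} k}

theorem con_add_left (c : KPFree K Λ) {a b : KPFree K Λ} (h : KPCon K Λ a b) :
    KPCon K Λ (c + a) (c + b) := by
  rw [add_comm c a, add_comm c b]; exact h.add_right c

theorem con_neg {a b : KPFree K Λ} (h : KPCon K Λ a b) : KPCon K Λ (-a) (-b) := by
  simpa only [neg_one_smul] using h.smul (-1)

instance : Zero (KP K Λ) where zero := Quot.mk _ 0

instance : Add (KP K Λ) where
  add := Quot.map₂ (· + ·) (fun c _ _ => con_add_left c) fun _ _ c h => h.add_right c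

instance : Neg (KP K Λ) where neg := Quot.map Neg.neg fun _ _ => con_neg

instance : Sub (KP K Λ) where
  sub := Quot.map₂ Sub.sub
    (fun c a b h => by
      change KPCon K Λ (c - a) (c - b)
      simpa only [sub_eq_add_neg] using con_add_left c (con_neg h))
    fun a b c h => by
      change KPCon K Λ (a - c) (b - c)
      simpa only [sub_eq_add_neg] using h.add_right (-c)

instance : Mul (KP K Λ) where
  mul := Quot.map₂ (· * ·) (fun c _ _ h => h.mul_left c) fun _ _ c h => h.mul_right c

instance {S : Type*} [Monoid S] [DistribMulAction S K] [IsScalarTower S K K] :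
    SMul S (KP K Λ) where
  smul t := Quot.map (t • ·) fun a b h => by
    rw [← smul_one_smul K t a, ← smul_one_smul K t b]; exact h.smul _

instance : NonUnitalRing (KP K Λ) :=
  Function.Surjective.nonUnitalRing (Quot.mk _) Quot.mk_surjective rfl (fun _ _ => rfl)
    (fun _ _ => rfl) (fun _ => rfl) (fun _ _ => rfl) (fun _ _ => rfl) (fun _ _ => rfl)

instance : Module K (KP K Λ) :=
  Function.Surjective.module K ⟨⟨Quot.mk (KPCon K Λ), rfl⟩, fun _ _ => rfl⟩
    Quot.mk_surjective (fun _ _ => rfl)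

instance : IsScalarTower K (KP K Λ) (KP K Λ) where
  smul_assoc := by
    rintro t ⟨a⟩ ⟨b⟩
    exact congrArg (Quot.mk _) (smul_mul_assoc t a b)

instance : SMulCommClass K (KP K Λ) (KP K Λ) where
  smul_comm := by
    rintro t ⟨a⟩ ⟨b⟩
    exact congrArg (Quot.mk _) (mul_smul_comm t a b).symm

/-- The canonical homomorphism from the free algebra. -/
def mk : KPFree K Λ →ₙₐ[K] KP K Λ where
  toFun := Quot.mk (KPCon K Λ)
  map_smul' _ _ := rfl
  map_zero' := rfl
  map_add' _ _ := rfl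
  map_mul' _ _ := rfl

/-- A homomorphism from the free algebra that respects the defining relations factors through the
Kumjian-Pask algebra. -/
def lift {A : Type*} [NonUnitalNonAssocSemiring A] [DistribMulAction K A]
    (φ : KPFree K Λ →ₙₐ[K] A)
    (h : ∀ a b, KPRelation K Λ a b → φ a = φ b) : KP K Λ →ₙₐ[K] A where
  toFun := Quot.lift φ fun a b hab => by
    induction hab with
    | of h1 => exact h _ _ h1
    | smul t _ ih => rw [map_smul, map_smul, ih]
    | add_right c _ ih => rw [map_add, map_add, ih]
    | mul_left c _ ih => rw [map_mul, map_mul, ih]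
    | mul_right c _ ih => rw [map_mul, map_mul, ih]
  map_smul' := by rintro t ⟨a⟩; exact map_smul φ t a
  map_zero' := map_zero φ
  map_add' := by rintro ⟨a⟩ ⟨b⟩; exact map_add φ a b
  map_mul' := by rintro ⟨a⟩ ⟨b⟩; exact map_mul φ a b

end KP

theorem exists_factorisation {Λ : KGraph.{u} k} (f : Λ.Path) (m n : Fin k → ℕ)
    (h : Λ.pathDeg f = m + n) : ∃ (g g' : Λ.Path) (hg : g.right = g'.left),
      f = compPath g g' hg ∧ Λ.pathDeg g = n ∧ Λ.pathDeg g' = m := by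
  obtain ⟨a, b, f⟩ := f
  obtain ⟨⟨c, g, g'⟩, ⟨h1, h2, h3⟩, -⟩ := Λ.factorisation f m n h
  refine ⟨⟨a, c, g⟩, ⟨c, b, g'⟩, rfl, ?_, h2, h1⟩
  rw [compPath_mk, h3]

end KGraph

namespace RepKGraph

open KGraph

variable {k : ℕ} {Λ : KGraph.{u} k}

section action

variable (K : Type*) [Field K] (X : RepKGraph Λ)

/-- The `K`-vector space `V_(Δ,α)` with basis the set of vertices of `Δ`. -/
abbrev V : Type _ := X.graph.Ob →₀ K

variable {X} in
/-- A vertex of `Δ` as a basis element of `V_(Δ,α)`. -/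
abbrev vtx (v : X.graph.Ob) : X.V K := Finsupp.single v 1

open Classical in
/-- The endomorphism `σ_f`: it maps a vertex `v` to `r(δ)` if there is a path `δ` with source `v`
and `α(δ) = f`, and to `0` otherwise. -/
def sigma (f : Λ.Path) : Module.End K (X.V K) :=
  Finsupp.linearCombination K fun v =>
    if h : ∃ δ : X.graph.Path, δ.left = v ∧ X.hom.onPath δ = f then vtx K h.choose.right else 0

open Classical in
/-- The endomorphism `σ_{f*}`: it maps a vertex `v` to `s(δ)` if there is a path `δ` with range `v`
and `α(δ) = f`, and to `0` otherwise. -/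
def sigmaStar (f : Λ.Path) : Module.End K (X.V K) :=
  Finsupp.linearCombination K fun v =>
    if h : ∃ δ : X.graph.Path, δ.right = v ∧ X.hom.onPath δ = f then vtx K h.choose.left else 0

theorem sigma_of {v : X.graph.Ob} {f : Λ.Path} (δ : X.graph.Path) (hv : δ.left = v)
    (hf : X.hom.onPath δ = f) : X.sigma K f (vtx K v) = vtx K δ.right := by
  have h : ∃ δ : X.graph.Path, δ.left = v ∧ X.hom.onPath δ = f := ⟨δ, hv, hf⟩
  have e : h.choose = δ :=
    X.path_eq_of_left (h.choose_spec.1.trans hv.symm) (h.choose_spec.2.trans hf.symm)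
  rw [sigma, Finsupp.linearCombination_single, one_smul, dif_pos h, e]

theorem sigma_zero {v : X.graph.Ob} {f : Λ.Path}
    (h : ¬ ∃ δ : X.graph.Path, δ.left = v ∧ X.hom.onPath δ = f) :
    X.sigma K f (vtx K v) = 0 := by
  rw [sigma, Finsupp.linearCombination_single, one_smul, dif_neg h]

theorem sigmaStar_of {v : X.graph.Ob} {f : Λ.Path} (δ : X.graph.Path) (hv : δ.right = v)
    (hf : X.hom.onPath δ = f) : X.sigmaStar K f (vtx K v) = vtx K δ.left := by
  have h : ∃ δ : X.graph.Path, δ.right = v ∧ X.hom.onPath δ = f := ⟨δ, hv, hf⟩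
  have e : h.choose = δ :=
    X.path_eq_of_right (h.choose_spec.1.trans hv.symm) (h.choose_spec.2.trans hf.symm)
  rw [sigmaStar, Finsupp.linearCombination_single, one_smul, dif_pos h, e]

theorem sigmaStar_zero {v : X.graph.Ob} {f : Λ.Path}
    (h : ¬ ∃ δ : X.graph.Path, δ.right = v ∧ X.hom.onPath δ = f) :
    X.sigmaStar K f (vtx K v) = 0 := by
  rw [sigmaStar, Finsupp.linearCombination_single, one_smul, dif_neg h]

theorem exists_from_iff (v : X.graph.Ob) (f : Λ.Path) :
    (∃ δ : X.graph.Path, δ.left = v ∧ X.hom.onPath δ = f) ↔ f.left = X.hom.onOb v := by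
  constructor
  · rintro ⟨δ, rfl, rfl⟩; rfl
  · intro h; exact (X.bijOn_from v).surjOn h

theorem sigma_idPath (w : Λ.Ob) (v : X.graph.Ob) [Decidable (w = X.hom.onOb v)] :
    X.sigma K (Λ.idPath w) (vtx K v) = if w = X.hom.onOb v then vtx K v else 0 := by
  split_ifs with h
  · subst h
    exact X.sigma_of K (X.graph.idPath v) rfl (X.hom.onPath_idPath v)
  · exact X.sigma_zero K fun h' => h ((X.exists_from_iff v _).1 h')

theorem end_ext {φ ψ : Module.End K (X.V K)} (h : ∀ v, φ (vtx K v) = ψ (vtx K v)) : φ = ψ :=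
  Finsupp.lhom_ext' fun v => LinearMap.ext_ring (h v)

theorem sigmaStar_of_deg_zero (f : Λ.Path) (h : Λ.pathDeg f = 0) :
    X.sigmaStar K f = X.sigma K f := by
  refine X.end_ext K fun v => ?_
  obtain ⟨w, rfl⟩ : ∃ w, f = Λ.idPath w := ⟨_, eq_idPath_of_pathDeg f h⟩
  classical
  rw [sigma_idPath]
  split_ifs with hw
  · subst hw
    exact X.sigmaStar_of K (X.graph.idPath v) rfl (X.hom.onPath_idPath v)
  · refine X.sigmaStar_zero K ?_
    rintro ⟨δ, rfl, hδ⟩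
    exact hw (congrArg Quiver.Total.right hδ).symm

/-- The action of the generators. -/
def genAction : Λ.KPGen → Module.End K (X.V K)
  | .path f => X.sigma K f
  | .ghost f _ => X.sigmaStar K f

/-- The action of the free algebra. -/
def freeAction : KPFree K Λ →ₙₐ[K] Module.End K (X.V K) :=
  MonoidAlgebra.liftMagma K (FreeSemigroup.lift (X.genAction K))

theorem freeAction_kpGen (x : Λ.KPGen) : X.freeAction K (kpGen K x) = X.genAction K x := by
  simp [freeAction, kpGen]

theorem freeAction_kpPath (f : Λ.Path) : X.freeAction K (kpPath K f) = X.sigma K f :=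
  X.freeAction_kpGen K _

theorem freeAction_kpStar (f : Λ.Path) : X.freeAction K (kpStar K f) = X.sigmaStar K f := by
  rw [kpStar, freeAction_kpGen, KPGen.star]
  split_ifs with h
  · exact (X.sigmaStar_of_deg_zero K f h).symm
  · rfl

theorem sigma_mul (f g : Λ.Path) (h : g.right = f.left) :
    X.sigma K f * X.sigma K g = X.sigma K (compPath g f h) := by
  refine X.end_ext K fun v => ?_
  rw [Module.End.mul_apply]
  by_cases hg : ∃ δ : X.graph.Path, δ.left = v ∧ X.hom.onPath δ = g
  · obtain ⟨δ, rfl, rfl⟩ := hg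
    obtain ⟨ε, hε, rfl⟩ := (X.exists_from_iff δ.right f).2 h.symm
    rw [X.sigma_of K δ rfl rfl, X.sigma_of K ε hε rfl]
    exact (X.sigma_of K (compPath δ ε hε.symm) rfl (X.hom.onPath_compPath _ _ _)).symm
  · rw [X.sigma_zero K hg, map_zero, X.sigma_zero K]
    rw [exists_from_iff] at hg ⊢
    exact hg

theorem sigma_mul_zero (f g : Λ.Path) (h : g.right ≠ f.left) :
    X.sigma K f * X.sigma K g = 0 := by
  refine X.end_ext K fun v => ?_
  rw [Module.End.mul_apply]
  by_cases hg : ∃ δ : X.graph.Path, δ.left = v ∧ X.hom.onPath δ = g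
  · obtain ⟨δ, rfl, rfl⟩ := hg
    rw [X.sigma_of K δ rfl rfl, X.sigma_zero K]
    · rfl
    · rw [exists_from_iff]
      exact fun h' => h h'.symm
  · rw [X.sigma_zero K hg, map_zero]
    rfl

theorem sigmaStar_mul (f g : Λ.Path) (h : g.right = f.left) :
    X.sigmaStar K g * X.sigmaStar K f = X.sigmaStar K (compPath g f h) := by
  refine X.end_ext K fun v => ?_
  rw [Module.End.mul_apply]
  by_cases hc : ∃ γ : X.graph.Path, γ.right = v ∧ X.hom.onPath γ = compPath g f h
  · obtain ⟨γ, rfl, hγ⟩ := hc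
    obtain ⟨ε, δ, hεδ, rfl, h1, h2⟩ := exists_factorisation γ (Λ.pathDeg f) (Λ.pathDeg g)
      (by rw [← X.hom.pathDeg_onPath, hγ, pathDeg_compPath, add_comm])
    have hγ' := hγ
    rw [X.hom.onPath_compPath] at hγ'
    obtain ⟨hg, hf⟩ := compPath_unique _ _ hγ' (by rw [X.hom.pathDeg_onPath, h1])
      (by rw [X.hom.pathDeg_onPath, h2])
    rw [X.sigmaStar_of K _ rfl hγ, X.sigmaStar_of K (v := (compPath ε δ hεδ).right) δ rfl hf,
      X.sigmaStar_of K ε hεδ hg]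
    rfl
  · rw [X.sigmaStar_zero K hc]
    by_cases hf : ∃ δ : X.graph.Path, δ.right = v ∧ X.hom.onPath δ = f
    · obtain ⟨δ, rfl, rfl⟩ := hf
      rw [X.sigmaStar_of K δ rfl rfl]
      refine X.sigmaStar_zero K ?_
      rintro ⟨ε, hε, rfl⟩
      exact hc ⟨compPath ε δ hε, rfl, X.hom.onPath_compPath _ _ _⟩
    · rw [X.sigmaStar_zero K hf, map_zero]

theorem sigmaStar_mul_zero (f g : Λ.Path) (h : g.right ≠ f.left) :
    X.sigmaStar K g * X.sigmaStar K f = 0 := by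
  refine X.end_ext K fun v => ?_
  rw [Module.End.mul_apply]
  by_cases hf : ∃ δ : X.graph.Path, δ.right = v ∧ X.hom.onPath δ = f
  · obtain ⟨δ, rfl, rfl⟩ := hf
    rw [X.sigmaStar_of K δ rfl rfl]
    refine X.sigmaStar_zero K ?_
    rintro ⟨ε, hε, rfl⟩
    exact h (congrArg X.hom.onOb hε)
  · rw [X.sigmaStar_zero K hf, map_zero]
    rfl

theorem sigmaStar_mul_sigma (f : Λ.Path) :
    X.sigmaStar K f * X.sigma K f = X.sigma K (Λ.idPath f.left) := by
  refine X.end_ext K fun v => ?_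
  classical
  rw [Module.End.mul_apply, sigma_idPath]
  split_ifs with h
  · obtain ⟨δ, rfl, rfl⟩ := (X.exists_from_iff v f).2 h
    rw [X.sigma_of K δ rfl rfl, X.sigmaStar_of K δ rfl rfl]
  · rw [X.sigma_zero K (fun h' => h ((X.exists_from_iff v f).1 h')), map_zero]

theorem sigmaStar_mul_sigma_zero (f g : Λ.Path) (hd : Λ.pathDeg f = Λ.pathDeg g) (h : f ≠ g) :
    X.sigmaStar K f * X.sigma K g = 0 := by
  refine X.end_ext K fun v => ?_
  rw [Module.End.mul_apply]
  by_cases hg : ∃ δ : X.graph.Path, δ.left = v ∧ X.hom.onPath δ = g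
  · obtain ⟨δ, rfl, rfl⟩ := hg
    rw [X.sigma_of K δ rfl rfl]
    refine X.sigmaStar_zero K ?_
    rintro ⟨ε, hε, rfl⟩
    rw [X.hom.pathDeg_onPath, X.hom.pathDeg_onPath] at hd
    obtain rfl := (X.existsUnique_to δ.right (X.graph.pathDeg δ)).unique ⟨hε, hd⟩ ⟨rfl, rfl⟩
    exact h rfl
  · rw [X.sigma_zero K hg, map_zero]
    rfl

theorem sum_sigma_mul_sigmaStar (w : Λ.Ob) (n : Fin k → ℕ) :
    ∑ f ∈ (Λ.pathsToDeg_finite w n).toFinset, X.sigma K f * X.sigmaStar K f =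
      X.sigma K (Λ.idPath w) := by
  refine X.end_ext K fun v => ?_
  classical
  rw [LinearMap.sum_apply, sigma_idPath]
  obtain ⟨δ, ⟨rfl, hn⟩, -⟩ := X.existsUnique_to v n
  have key : ∀ f ∈ (Λ.pathsToDeg_finite w n).toFinset, f ≠ X.hom.onPath δ →
      (X.sigma K f * X.sigmaStar K f) (vtx K δ.right) = 0 := by
    intro f hf hne
    rw [Set.Finite.mem_toFinset] at hf
    rw [Module.End.mul_apply, X.sigmaStar_zero K, map_zero]
    rintro ⟨ε, hε, rfl⟩
    apply hne
    obtain rfl := (X.existsUnique_to δ.right n).unique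
      ⟨hε, by rw [← hf.2, X.hom.pathDeg_onPath]⟩ ⟨rfl, hn⟩
    rfl
  split_ifs with h
  · subst h
    rw [Finset.sum_eq_single (X.hom.onPath δ) key]
    · rw [Module.End.mul_apply, X.sigmaStar_of K δ rfl rfl, X.sigma_of K δ rfl rfl]
    · intro h'
      have h1 : X.hom.onPath δ ∈ Λ.pathsToDeg (X.hom.onOb δ.right) n :=
        ⟨rfl, by rw [X.hom.pathDeg_onPath, hn]⟩
      exact absurd ((Set.Finite.mem_toFinset _).2 h1) h'
  · refine Finset.sum_eq_zero fun f hf => key f hf ?_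
    rintro rfl
    rw [Set.Finite.mem_toFinset] at hf
    exact h hf.1.symm

/-- The left `KP(Λ)`-module structure on `V_(Δ,α)`: the algebra homomorphism
`KP(Λ) → End_K(V_(Δ,α))` with `f ↦ σ_f` and `f* ↦ σ_{f*}`. -/
def action : KP K Λ →ₙₐ[K] Module.End K (X.V K) :=
  KP.lift (K := K) (Λ := Λ) (X.freeAction K) fun a b h => by
    cases h with
    | kp1 f g h => simp only [map_mul, freeAction_kpPath, X.sigma_mul K f g h]
    | kp1_zero f g h => simp only [map_mul, freeAction_kpPath, X.sigma_mul_zero K f g h, map_zero]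
    | kp2 f g h => simp only [map_mul, freeAction_kpStar, X.sigmaStar_mul K f g h]
    | kp2_zero f g h =>
      simp only [map_mul, freeAction_kpStar, X.sigmaStar_mul_zero K f g h, map_zero]
    | kp3 f => simp only [map_mul, freeAction_kpStar, freeAction_kpPath, sigmaStar_mul_sigma]
    | kp3_zero f g hd h =>
      simp only [map_mul, freeAction_kpStar, freeAction_kpPath,
        X.sigmaStar_mul_sigma_zero K f g hd h, map_zero]
    | kp4 v n =>
      simp only [map_sum, map_mul, freeAction_kpStar, freeAction_kpPath, sum_sigma_mul_sigmaStar]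

end action

end RepKGraph

/-- A left module `V` over a (not necessarily unital) `K`-algebra `A`, given by an algebra
homomorphism `π : A → End_K(V)`, is indecomposable: it is nonzero and it is not the direct sum of
two nonzero submodules. -/
def IsIndecomposableModule {K A V : Type*} [Field K] [NonUnitalRing A] [Module K A]
    [AddCommGroup V] [Module K V] (π : A →ₙₐ[K] Module.End K V) : Prop :=
  Nontrivial V ∧ ∀ U W : Submodule K V,
    (∀ a : A, ∀ x ∈ U, π a x ∈ U) → (∀ a : A, ∀ x ∈ W, π a x ∈ W) →
    IsCompl U W → U = ⊥ ∨ W = ⊥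

/-- A ring has no nontrivial idempotents: the only idempotents are `0` and `1`. -/
def HasNoNontrivialIdempotents (R : Type*) [Ring R] : Prop :=
  ∀ e : R, IsIdempotentElem e → e = 0 ∨ e = 1

end

noncomputable section

/-! ### Generation of the free groupoid by morphisms and their inverses. -/

namespace CategoryTheory.FreeGroupoid

variable {C : Type u} [SmallCategory C]

/-- Every morphism of the free groupoid on a category is a composite of morphisms of the category
and inverses of such morphisms. -/
theorem hom_induction {a : C} (P : ∀ b : C, (mk a ⟶ mk b) → Prop) (id : P a (𝟙 (mk a)))
    (comp : ∀ (b c : C) (g : mk a ⟶ mk b) (f : b ⟶ c), P b g → P c (g ≫ homMk f))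
    (comp_inv : ∀ (b c : C) (g : mk a ⟶ mk b) (f : c ⟶ b), P b g →
      P c (g ≫ Groupoid.inv (homMk f)))
    (b : C) (g : mk a ⟶ mk b) : P b g := by
  -- The free groupoid is a quotient of the free groupoid on the underlying quiver, itself a
  -- quotient of a path category. Lifting twice gives a word in forward and reversed arrows, on
  -- which one inducts.
  obtain ⟨g, rfl⟩ := (Quotient.functor (FreeGroupoid.homRel C)).map_surjective g
  obtain ⟨p, rfl⟩ := (Quotient.functor (Quiver.FreeGroupoid.redStep (V := C))).map_surjective g
  change Quiver.Path (V := Quiver.Symmetrify C) a b at p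
  induction p with
  | nil => exact id
  | cons p e ih =>
    obtain f | f := e
    · exact comp _ _ _ f ih
    · exact comp_inv _ _ _ f ih

end CategoryTheory.FreeGroupoid

/-! ### Unique path lifting for coverings. -/

namespace KGraph

variable {k : ℕ}

/-- A covering lifts every path uniquely to a path with prescribed source. -/
theorem IsCovering.existsUnique_from {Ω Γ : KGraph.{u} k} {q : Hom Ω Γ} (hq : IsCovering q)
    {v : Ω.Ob} {f : Γ.Path} (h : q.onOb v = f.left) :
    ∃! g : Ω.Path, g.left = v ∧ q.onPath g = f := by
  obtain ⟨g, hg, e⟩ := (hq v).1.surjOn (show f ∈ Γ.pathsFrom (q.onOb v) from h.symm)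
  exact ⟨g, ⟨hg, e⟩, fun g' hg' => (hq v).1.injOn hg'.1 hg (hg'.2.trans e.symm)⟩

/-- A covering lifts every path uniquely to a path with prescribed range. -/
theorem IsCovering.existsUnique_to {Ω Γ : KGraph.{u} k} {q : Hom Ω Γ} (hq : IsCovering q)
    {v : Ω.Ob} {f : Γ.Path} (h : q.onOb v = f.right) :
    ∃! g : Ω.Path, g.right = v ∧ q.onPath g = f := by
  obtain ⟨g, hg, e⟩ := (hq v).2.surjOn (show f ∈ Γ.pathsTo (q.onOb v) from h.symm)
  exact ⟨g, ⟨hg, e⟩, fun g' hg' => (hq v).2.injOn hg'.1 hg (hg'.2.trans e.symm)⟩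

/-- A set of vertices which is closed under passing to the other end of a path and is nonempty
contains all vertices. -/
theorem induct_on_vertices (Λ : KGraph.{u} k) (P : Λ.Ob → Prop) {v₀ : Λ.Ob} (h₀ : P v₀)
    (h : ∀ f : Λ.Path, P f.left ↔ P f.right) (v : Λ.Ob) : P v := by
  have := Λ.connected
  exact induct_on_objects {v | P v} h₀ (fun {a b} f => h ⟨a, b, f⟩) v

/-- A covering is surjective on vertices. -/
theorem IsCovering.surjective_onOb {Ω Γ : KGraph.{u} k} {q : Hom Ω Γ} (hq : IsCovering q) :
    Function.Surjective q.onOb := by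
  obtain ⟨v₀⟩ := Ω.connected.is_nonempty
  refine Γ.induct_on_vertices (fun w => ∃ v, q.onOb v = w) ⟨v₀, rfl⟩ fun f => ⟨?_, ?_⟩
  · rintro ⟨v, hv⟩
    obtain ⟨g, ⟨-, rfl⟩, -⟩ := hq.existsUnique_from hv
    exact ⟨g.right, rfl⟩
  · rintro ⟨v, hv⟩
    obtain ⟨g, ⟨-, rfl⟩, -⟩ := hq.existsUnique_to hv
    exact ⟨g.left, rfl⟩

/-! ### The covering by classes of walks from a base vertex -/

/-- The vertices of the covering of `Δ` by homotopy classes: a vertex of `Δ` together with a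
morphism to it from the base vertex `x` in the fundamental groupoid. -/
structure ClassOb (Δ : KGraph.{u} k) (x : Δ.Ob) : Type u where
  pt : Δ.Ob
  cls : FreeGroupoid.mk x ⟶ FreeGroupoid.mk pt

namespace ClassOb

variable {Δ : KGraph.{u} k} {x : Δ.Ob}

/-- A morphism of `ClassOb`: a morphism of `Δ` compatible with the classes. -/
@[ext]
structure Hom (a b : ClassOb Δ x) : Type u where
  hom : a.pt ⟶ b.pt
  comm : a.cls ≫ FreeGroupoid.homMk hom = b.cls

instance : SmallCategory (ClassOb Δ x) where
  Hom := Hom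
  id a := ⟨𝟙 _, by rw [FreeGroupoid.homMk, CategoryTheory.Functor.map_id, Category.comp_id]⟩
  comp f g := ⟨f.hom ≫ g.hom, by
    rw [FreeGroupoid.homMk, CategoryTheory.Functor.map_comp, ← Category.assoc, f.comm, g.comm]⟩
  id_comp f := Hom.ext (Category.id_comp f.hom)
  comp_id f := Hom.ext (Category.comp_id f.hom)
  assoc f g h := Hom.ext (Category.assoc f.hom g.hom h.hom)

variable (Δ x) in
/-- The projection to `Δ`. -/
def forget : ClassOb Δ x ⥤ Δ.Ob where
  obj a := a.pt
  map f := Hom.hom f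

/-- The path with source `a` over a path of `Δ`. -/
def liftFrom (a : ClassOb Δ x) {w : Δ.Ob} (f : a.pt ⟶ w) :
    a ⟶ (⟨w, a.cls ≫ FreeGroupoid.homMk f⟩ : ClassOb Δ x) := Hom.mk f rfl

/-- The path with range `b` over a path of `Δ`. -/
def liftTo (b : ClassOb Δ x) {v : Δ.Ob} (f : v ⟶ b.pt) :
    (⟨v, b.cls ≫ Groupoid.inv (FreeGroupoid.homMk f)⟩ : ClassOb Δ x) ⟶ b :=
  Hom.mk f (by simp)

/-- The class at the range is forced: it is the class at the source followed by the path. -/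
theorem total_ext_from {f g : Quiver.Total (ClassOb Δ x)} (h : f.left = g.left)
    (e : (⟨_, _, (forget Δ x).map f.hom⟩ : Δ.Path) = ⟨_, _, (forget Δ x).map g.hom⟩) : f = g := by
  obtain ⟨a, ⟨w, c⟩, ⟨f, hf⟩⟩ := f
  obtain ⟨a', ⟨w', c'⟩, ⟨g, hg⟩⟩ := g
  obtain rfl : a = a' := h
  obtain ⟨-, h2, h3⟩ := (Quiver.Total.mk.injEq ..).mp e
  obtain rfl : w = w' := h2
  obtain rfl : f = g := eq_of_heq h3
  obtain rfl : c = c' := hf.symm.trans hg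
  rfl

theorem total_ext_to {f g : Quiver.Total (ClassOb Δ x)} (h : f.right = g.right)
    (e : (⟨_, _, (forget Δ x).map f.hom⟩ : Δ.Path) = ⟨_, _, (forget Δ x).map g.hom⟩) : f = g := by
  obtain ⟨⟨v, c⟩, a, ⟨f, hf⟩⟩ := f
  obtain ⟨⟨v', c'⟩, a', ⟨g, hg⟩⟩ := g
  obtain rfl : a = a' := h
  obtain ⟨h2, -, h3⟩ := (Quiver.Total.mk.injEq ..).mp e
  obtain rfl : v = v' := h2
  obtain rfl : f = g := eq_of_heq h3
  obtain rfl : c = c' := (cancel_mono (FreeGroupoid.homMk f)).1 (hf.trans hg.symm)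
  rfl

/-- Degrees and composites are those of `Δ`, and the class at the middle vertex must be `a.cls`
followed by the first factor. So the factorisation in `Δ` lifts in exactly one way. -/
theorem factorisation {a b : ClassOb Δ x} (f : a ⟶ b) (m n : Fin k → ℕ)
    (h : Δ.deg ((forget Δ x).map f) = m + n) :
    ∃! p : Σ c : ClassOb Δ x, (a ⟶ c) × (c ⟶ b),
      Δ.deg ((forget Δ x).map p.2.2) = m ∧ Δ.deg ((forget Δ x).map p.2.1) = n ∧
        p.2.1 ≫ p.2.2 = f := by
  obtain ⟨⟨c, g, g'⟩, ⟨h1, h2, h3⟩, hu⟩ := Δ.factorisation ((forget Δ x).map f) m n h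
  dsimp only at h1 h2 h3
  change a.pt ⟶ c at g
  change c ⟶ b.pt at g'
  have hg' : (a.cls ≫ FreeGroupoid.homMk g) ≫ FreeGroupoid.homMk g' = b.cls := by
    refine Eq.trans ?_ (Hom.comm f)
    rw [Category.assoc]
    refine congrArg (a.cls ≫ ·) ?_
    exact ((FreeGroupoid.of Δ.Ob).map_comp g g').symm.trans
      (congrArg (FreeGroupoid.of Δ.Ob).map h3)
  refine ⟨⟨_, a.liftFrom g, Hom.mk g' hg'⟩, ⟨h1, h2, Hom.ext h3⟩, ?_⟩
  rintro ⟨⟨w, c'⟩, ⟨p, hp⟩, ⟨p', hp'⟩⟩ ⟨d1, d2, e⟩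
  have h : (⟨w, p, p'⟩ : Σ c : Δ.Ob, (a.pt ⟶ c) × (c ⟶ b.pt)) = ⟨c, g, g'⟩ :=
    hu ⟨w, p, p'⟩ ⟨d1, d2, congrArg (forget Δ x).map e⟩
  obtain ⟨rfl, h'⟩ := Sigma.mk.inj_iff.1 h
  obtain ⟨rfl, rfl⟩ := (Prod.mk.injEq ..).mp (eq_of_heq h')
  dsimp only at p
  obtain rfl : a.cls ≫ FreeGroupoid.homMk p = c' := hp
  rfl

/-- A word in paths and inverses that represents `g` lifts, letter by letter, to a zigzag from the
base vertex with trivial class to the vertex with class `g`. -/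
theorem isConnected (Δ : KGraph.{u} k) (x : Δ.Ob) : CategoryTheory.IsConnected (ClassOb Δ x) := by
  have : Nonempty (ClassOb Δ x) := ⟨⟨x, 𝟙 _⟩⟩
  have key : ∀ a : ClassOb Δ x, Zigzag (⟨x, 𝟙 _⟩ : ClassOb Δ x) a := by
    rintro ⟨v, g⟩
    refine FreeGroupoid.hom_induction (fun v g => Zigzag (⟨x, 𝟙 _⟩ : ClassOb Δ x) ⟨v, g⟩)
      (Zigzag.refl _) ?_ ?_ v g
    · intro b c g f hg
      exact hg.trans (Zigzag.of_hom (liftFrom ⟨b, g⟩ f))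
    · intro b c g f hg
      exact hg.trans (Zigzag.of_inv (liftTo ⟨b, g⟩ f))
  exact zigzag_isConnected fun a b => (key a).symm.trans (key b)

end ClassOb

/-- The covering of `Δ` whose vertices are the morphisms with source `x` in the fundamental
groupoid. -/
def classGraph (Δ : KGraph.{u} k) (x : Δ.Ob) : KGraph.{u} k where
  Ob := ClassOb Δ x
  deg f := Δ.deg ((ClassOb.forget Δ x).map f)
  deg_id a := Δ.deg_id a.pt
  deg_comp _ _ := Δ.deg_comp _ _
  factorisation := ClassOb.factorisation
  connected := ClassOb.isConnected Δ x
  rowFinite a n := by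
    refine Set.Finite.of_finite_image (f := fun f : Quiver.Total (ClassOb Δ x) =>
      (⟨_, _, (ClassOb.forget Δ x).map f.hom⟩ : Δ.Path))
      ((Δ.pathsToDeg_finite a.pt n).subset ?_) ?_
    · rintro _ ⟨f, ⟨rfl, hf⟩, rfl⟩
      exact ⟨rfl, hf⟩
    · rintro f ⟨hf, -⟩ g ⟨hg, -⟩ e
      exact ClassOb.total_ext_to (hf.trans hg.symm) e
  noSources a n := by
    obtain ⟨⟨v, w, f⟩, hw, hf⟩ := Δ.noSources a.pt n
    dsimp at hw
    subst hw
    exact ⟨⟨_, a, a.liftTo f⟩, rfl, hf⟩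

/-- The projection from `classGraph Δ x` to `Δ`. -/
def classHom (Δ : KGraph.{u} k) (x : Δ.Ob) : Hom (Δ.classGraph x) Δ where
  toFunctor := ClassOb.forget Δ x
  deg_map _ := rfl

theorem isCovering_classHom (Δ : KGraph.{u} k) (x : Δ.Ob) : IsCovering (Δ.classHom x) := by
  intro a
  refine ⟨⟨?_, ?_, ?_⟩, ?_, ?_, ?_⟩
  · rintro f rfl; rfl
  · intro f hf g hg e
    exact ClassOb.total_ext_from (Eq.trans hf (Eq.symm hg)) e
  · rintro ⟨v, w, f⟩ hv
    obtain rfl : v = a.pt := hv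
    exact ⟨⟨a, _, ClassOb.liftFrom a f⟩, rfl, rfl⟩
  · rintro f rfl; rfl
  · intro f hf g hg e
    exact ClassOb.total_ext_to (Eq.trans hf (Eq.symm hg)) e
  · rintro ⟨v, w, f⟩ hw
    obtain rfl : w = a.pt := hw
    exact ⟨⟨_, a, ClassOb.liftTo a f⟩, rfl, rfl⟩

/-- The fundamental groupoid of the base is trivialised over a universal covering. -/
theorem IsUniversalCovering.exists_trivialisation {Ω Δ : KGraph.{u} k} {τ : Hom Ω Δ}
    (hτ : IsUniversalCovering τ) (x : Δ.Ob) :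
    ∃ g : ∀ v : Ω.Ob, FreeGroupoid.mk x ⟶ FreeGroupoid.mk (τ.toFunctor.obj v),
      ∀ {v w : Ω.Ob} (f : v ⟶ w), g v ≫ FreeGroupoid.homMk (τ.toFunctor.map f) = g w := by
  -- A morphism into this particular covering is the same as a choice of classes compatible with
  -- paths.
  obtain ⟨φ, rfl⟩ := hτ.2 _ _ (Δ.isCovering_classHom x)
  exact ⟨fun v => ClassOb.cls (φ.toFunctor.obj v), fun f =>
    ClassOb.Hom.comm (φ.toFunctor.map f)⟩

end KGraph

/-! ### Monodromy, and comparison of a trivialised covering with the covering by classes. -/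

namespace KGraph

variable {k : ℕ}

/-- The fibre of a morphism over a vertex. -/
abbrev Fibre {Ω Γ : KGraph.{u} k} (q : Hom Ω Γ) (a : Γ.Ob) : Type u := {v : Ω.Ob // q.onOb v = a}

/-- The groupoid whose objects are the vertices of `Γ` and whose morphisms are the bijections
between the fibres of `q`. -/
def FibreGroupoid {Ω Γ : KGraph.{u} k} (_ : Hom Ω Γ) : Type u := Γ.Ob

instance {Ω Γ : KGraph.{u} k} (q : Hom Ω Γ) : Groupoid (FibreGroupoid q) where
  Hom a b := Fibre q a ≃ Fibre q b
  id _ := Equiv.refl _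
  comp f g := Equiv.trans f g
  inv f := Equiv.symm f
  id_comp _ := rfl
  comp_id _ := rfl
  assoc _ _ _ := rfl
  inv_comp f := Equiv.symm_trans_self f
  comp_inv f := Equiv.self_trans_symm f

namespace IsCovering

variable {Ω Γ : KGraph.{u} k} {q : Hom Ω Γ} (hq : IsCovering q)

/-- The lift of a path to a path with prescribed source. -/
def liftFrom {v : Ω.Ob} {f : Γ.Path} (h : q.onOb v = f.left) : Ω.Path :=
  (hq.existsUnique_from h).choose

theorem liftFrom_left {v : Ω.Ob} {f : Γ.Path} (h : q.onOb v = f.left) :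
    (hq.liftFrom h).left = v := (hq.existsUnique_from h).choose_spec.1.1

theorem onPath_liftFrom {v : Ω.Ob} {f : Γ.Path} (h : q.onOb v = f.left) :
    q.onPath (hq.liftFrom h) = f := (hq.existsUnique_from h).choose_spec.1.2

theorem liftFrom_eq {v : Ω.Ob} {f : Γ.Path} (h : q.onOb v = f.left) {g : Ω.Path}
    (hv : g.left = v) (hf : q.onPath g = f) : hq.liftFrom h = g :=
  (hq.existsUnique_from h).unique (hq.existsUnique_from h).choose_spec.1 ⟨hv, hf⟩

/-- The lift of a path to a path with prescribed range. -/
def liftTo {v : Ω.Ob} {f : Γ.Path} (h : q.onOb v = f.right) : Ω.Path :=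
  (hq.existsUnique_to h).choose

theorem liftTo_right {v : Ω.Ob} {f : Γ.Path} (h : q.onOb v = f.right) :
    (hq.liftTo h).right = v := (hq.existsUnique_to h).choose_spec.1.1

theorem onPath_liftTo {v : Ω.Ob} {f : Γ.Path} (h : q.onOb v = f.right) :
    q.onPath (hq.liftTo h) = f := (hq.existsUnique_to h).choose_spec.1.2

theorem liftTo_eq {v : Ω.Ob} {f : Γ.Path} (h : q.onOb v = f.right) {g : Ω.Path}
    (hv : g.right = v) (hf : q.onPath g = f) : hq.liftTo h = g :=
  (hq.existsUnique_to h).unique (hq.existsUnique_to h).choose_spec.1 ⟨hv, hf⟩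

/-- The transport between fibres along a path. -/
def transport (f : Γ.Path) : Fibre q f.left ≃ Fibre q f.right where
  toFun v := ⟨(hq.liftFrom v.2).right, congrArg Quiver.Total.right (hq.onPath_liftFrom v.2)⟩
  invFun v := ⟨(hq.liftTo v.2).left, congrArg Quiver.Total.left (hq.onPath_liftTo v.2)⟩
  left_inv v := Subtype.ext (Eq.trans
    (congrArg Quiver.Total.left (hq.liftTo_eq _ rfl (hq.onPath_liftFrom v.2)))
    (hq.liftFrom_left v.2))
  right_inv v := Subtype.ext (Eq.trans
    (congrArg Quiver.Total.right (hq.liftFrom_eq _ rfl (hq.onPath_liftTo v.2)))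
    (hq.liftTo_right v.2))

theorem transport_apply {f : Γ.Path} {v : Fibre q f.left} {g : Ω.Path} (hv : g.left = v.1)
    (hg : q.onPath g = f) : (hq.transport f v).1 = g.right :=
  congrArg Quiver.Total.right (hq.liftFrom_eq v.2 hv hg)

theorem transport_onPath (f : Ω.Path) :
    hq.transport (q.onPath f) ⟨f.left, rfl⟩ = ⟨f.right, rfl⟩ :=
  Subtype.ext (hq.transport_apply rfl rfl)

/-- The functor given by the transport between fibres. -/
def fibreFunctor : Γ.Ob ⥤ FibreGroupoid q where
  obj a := a
  map {a b} f := hq.transport ⟨a, b, f⟩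
  map_id a := Equiv.ext fun v => Subtype.ext <|
    hq.transport_apply (f := ⟨a, a, 𝟙 a⟩) (v := v) (g := Ω.idPath v.1) rfl
      ((q.onPath_idPath v.1).trans (congrArg Γ.idPath v.2))
  map_comp {a b c} f g := by
    refine Equiv.ext ?_
    rintro ⟨v, hv⟩
    obtain ⟨f', ⟨rfl, hf⟩, -⟩ := hq.existsUnique_from (f := ⟨a, b, f⟩) hv
    obtain ⟨g', ⟨hg', hg⟩, -⟩ := hq.existsUnique_from (f := ⟨b, c, g⟩) (v := f'.right)
      (congrArg Quiver.Total.right hf)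
    have e : q.onPath (compPath f' g' hg'.symm) = ⟨a, c, f ≫ g⟩ := by
      rw [q.onPath_compPath, ← compPath_mk]
      exact compPath_congr hf hg _ _
    refine Subtype.ext ((hq.transport_apply (f := ⟨a, c, f ≫ g⟩) rfl e).trans ?_)
    exact (hq.transport_apply (f := ⟨b, c, g⟩) (v := hq.transport ⟨a, b, f⟩ ⟨f'.left, hv⟩)
      (hg'.trans (hq.transport_apply (f := ⟨a, b, f⟩) rfl hf).symm) hg).symm

/-- The monodromy action of the fundamental groupoid on the fibres of a covering. -/
def monodromy : FreeGroupoid Γ.Ob ⥤ FibreGroupoid q := FreeGroupoid.lift hq.fibreFunctor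

/-- The monodromy action of a morphism in the fundamental groupoid. -/
def transportClass {a b : Γ.Ob} (g : FreeGroupoid.mk a ⟶ FreeGroupoid.mk b) :
    Fibre q a ≃ Fibre q b := hq.monodromy.map g

theorem transportClass_id (a : Γ.Ob) :
    hq.transportClass (𝟙 (FreeGroupoid.mk a)) = Equiv.refl _ := hq.monodromy.map_id _

theorem transportClass_comp {a b c : Γ.Ob} (g : FreeGroupoid.mk a ⟶ FreeGroupoid.mk b)
    (g' : FreeGroupoid.mk b ⟶ FreeGroupoid.mk c) :
    hq.transportClass (g ≫ g') = (hq.transportClass g).trans (hq.transportClass g') :=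
  hq.monodromy.map_comp g g'

theorem transportClass_homMk {a b : Γ.Ob} (f : a ⟶ b) :
    hq.transportClass (FreeGroupoid.homMk f) = hq.transport ⟨a, b, f⟩ :=
  FreeGroupoid.lift_map_homMk hq.fibreFunctor f

theorem transportClass_inv {a b : Γ.Ob} (g : FreeGroupoid.mk a ⟶ FreeGroupoid.mk b) :
    hq.transportClass (Groupoid.inv g) = (hq.transportClass g).symm := by
  have h : (hq.transportClass g).trans (hq.transportClass (Groupoid.inv g)) = Equiv.refl _ := by
    rw [← transportClass_comp, Groupoid.comp_inv, transportClass_id]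
  refine Equiv.ext fun v => ?_
  obtain ⟨w, rfl⟩ := (hq.transportClass g).surjective v
  rw [Equiv.symm_apply_apply]
  exact congrArg (fun e : Fibre q a ≃ Fibre q a => e w) h

/-- Monodromy is transitive because `Ω` is connected: the vertices reached from `v₀` are closed
under passing to either end of a path, by composing with the image of that path or with its inverse.
-/
theorem exists_transportClass (v₀ v : Ω.Ob) :
    ∃ g : FreeGroupoid.mk (q.onOb v₀) ⟶ FreeGroupoid.mk (q.onOb v),
      hq.transportClass g ⟨v₀, rfl⟩ = ⟨v, rfl⟩ := by
  refine Ω.induct_on_vertices (fun v => ∃ g : FreeGroupoid.mk (q.onOb v₀) ⟶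
    FreeGroupoid.mk (q.onOb v), hq.transportClass g ⟨v₀, rfl⟩ = ⟨v, rfl⟩)
    ⟨𝟙 _, by rw [transportClass_id]; rfl⟩ (fun f => ⟨?_, ?_⟩) v
  · rintro ⟨g, hg⟩
    refine ⟨g ≫ FreeGroupoid.homMk (q.onPath f).hom, ?_⟩
    rw [transportClass_comp, Equiv.trans_apply, hg]
    refine (congrArg (fun e : Fibre q (q.onOb f.left) ≃ Fibre q (q.onOb f.right) =>
      e ⟨f.left, rfl⟩) (hq.transportClass_homMk (q.onPath f).hom)).trans ?_
    exact hq.transport_onPath f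
  · rintro ⟨g, hg⟩
    refine ⟨g ≫ Groupoid.inv (FreeGroupoid.homMk (q.onPath f).hom), ?_⟩
    rw [transportClass_comp, Equiv.trans_apply, hg, transportClass_inv, Equiv.symm_apply_eq]
    refine Eq.symm ?_
    refine (congrArg (fun e : Fibre q (q.onOb f.left) ≃ Fibre q (q.onOb f.right) =>
      e ⟨f.left, rfl⟩) (hq.transportClass_homMk (q.onPath f).hom)).trans ?_
    exact hq.transport_onPath f

variable {y : Γ.Ob} (t : ∀ v : Ω.Ob, FreeGroupoid.mk y ⟶ FreeGroupoid.mk (q.toFunctor.obj v))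

/-- The class of a vertex of the fibre over `a`, as a morphism to `a`. -/
def fibreClass {a : Γ.Ob} (v : Fibre q a) : FreeGroupoid.mk y ⟶ FreeGroupoid.mk a :=
  t v.1 ≫ eqToHom (congrArg FreeGroupoid.mk v.2)

theorem fibreClass_mk (v : Ω.Ob) : fibreClass t (⟨v, rfl⟩ : Fibre q (q.onOb v)) = t v :=
  Category.comp_id _

theorem fibreClass_transport
    (ht : ∀ {v w : Ω.Ob} (f : v ⟶ w), t v ≫ FreeGroupoid.homMk (q.toFunctor.map f) = t w)
    (f : Γ.Path) (v : Fibre q f.left) :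
    fibreClass t (hq.transport f v) = fibreClass t v ≫ FreeGroupoid.homMk f.hom := by
  obtain ⟨v, hv⟩ := v
  obtain ⟨f', ⟨rfl, rfl⟩, -⟩ := hq.existsUnique_from hv
  rw [transport_onPath]
  exact (fibreClass_mk t _).trans ((ht f'.hom).symm.trans
    (congrArg (· ≫ FreeGroupoid.homMk (q.onPath f').hom) (fibreClass_mk t _).symm))

/-- The trivialisation turns monodromy into composition on the right. The compatibility `ht` gives
this for a single path, and the general case follows by writing `g` as a word in paths and inverses.
-/
theorem fibreClass_transportClass
    (ht : ∀ {v w : Ω.Ob} (f : v ⟶ w), t v ≫ FreeGroupoid.homMk (q.toFunctor.map f) = t w)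
    {a b : Γ.Ob} (g : FreeGroupoid.mk a ⟶ FreeGroupoid.mk b)
    (v : Fibre q a) : fibreClass t (hq.transportClass g v) = fibreClass t v ≫ g := by
  refine FreeGroupoid.hom_induction
    (fun b g => fibreClass t (hq.transportClass g v) = fibreClass t v ≫ g) ?_ ?_ ?_ b g
  · rw [transportClass_id, Category.comp_id]; rfl
  · intro b c g f ih
    rw [transportClass_comp, Equiv.trans_apply, transportClass_homMk]
    refine (hq.fibreClass_transport t ht ⟨b, c, f⟩ _).trans ?_
    rw [ih, Category.assoc]
  · intro b c g f ih
    rw [transportClass_comp, Equiv.trans_apply, transportClass_inv, transportClass_homMk,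
      ← Category.assoc, ← ih]
    obtain ⟨w, hw⟩ := (hq.transport ⟨c, b, f⟩).surjective (hq.transportClass g v)
    rw [← hw, Equiv.symm_apply_apply, hq.fibreClass_transport t ht ⟨c, b, f⟩ w, Category.assoc,
      Groupoid.comp_inv, Category.comp_id]

/-- If `v` and `w` have the same image and the same class, a groupoid morphism carrying `v` to `w`
composes with `t v` to give `t v` again. It is therefore trivial, and `v = w`. Surjectivity is
obtained by transporting a vertex over `y`. -/
theorem bijective_class (hq : IsCovering q)
    (ht : ∀ {v w : Ω.Ob} (f : v ⟶ w), t v ≫ FreeGroupoid.homMk (q.toFunctor.map f) = t w) :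
    Function.Bijective fun v : Ω.Ob => (⟨q.onOb v, t v⟩ : ClassOb Γ y) := by
  constructor
  · intro v w h
    obtain ⟨h1, h2⟩ := (ClassOb.mk.injEq ..).mp h
    obtain ⟨g, hg⟩ := hq.exists_transportClass v w
    -- Here and in `h4` the vertex of `Γ` is generalised, so that the equality `q.onOb w = q.onOb v`
    -- can be eliminated.
    have h3 : fibreClass t (⟨w, h1.symm⟩ : Fibre q (q.onOb v)) = t v := by
      have : ∀ (a : Γ.Ob) (e : q.onOb w = a) (s : FreeGroupoid.mk y ⟶ FreeGroupoid.mk a),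
          s ≍ t w → fibreClass t (⟨w, e⟩ : Fibre q a) = s := by
        rintro _ rfl s hs
        rw [eq_of_heq hs, fibreClass_mk]
      exact this _ h1.symm _ h2
    have h4 : ∀ (a : Γ.Ob) (e : q.onOb w = a) (g' : FreeGroupoid.mk (q.onOb v) ⟶
        FreeGroupoid.mk a), g' = g ≫ eqToHom (congrArg FreeGroupoid.mk e) →
        hq.transportClass g' ⟨v, rfl⟩ = ⟨w, e⟩ := by
      rintro _ rfl g' rfl
      rw [eqToHom_refl, Category.comp_id, hg]
    have h5 := h4 _ h1.symm _ rfl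
    have h6 := hq.fibreClass_transportClass t ht
      (g ≫ eqToHom (congrArg FreeGroupoid.mk h1.symm)) ⟨v, rfl⟩
    rw [h5, h3, fibreClass_mk] at h6
    have h7 : 𝟙 _ = g ≫ eqToHom (congrArg FreeGroupoid.mk h1.symm) :=
      (cancel_epi (t v)).1 ((Category.comp_id _).trans h6)
    rw [← h7, transportClass_id] at h5
    exact congrArg Subtype.val h5
  · rintro ⟨a, g⟩
    obtain ⟨v, hv⟩ := hq.surjective_onOb y
    -- Transport multiplies the class of `v` on the right, so undoing that class before applying `g`
    -- yields a vertex of class exactly `g`.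
    obtain ⟨⟨w, rfl⟩, hw⟩ : ∃ w, hq.transportClass
      (Groupoid.inv (fibreClass t (⟨v, hv⟩ : Fibre q y)) ≫ g) ⟨v, hv⟩ = w := ⟨_, rfl⟩
    have h := hq.fibreClass_transportClass t ht
      (Groupoid.inv (fibreClass t (⟨v, hv⟩ : Fibre q y)) ≫ g) ⟨v, hv⟩
    rw [hw, fibreClass_mk, ← Category.assoc, Groupoid.comp_inv, Category.id_comp] at h
    exact ⟨w, congrArg (ClassOb.mk (q.onOb w)) h⟩

end IsCovering

/-! ### The action of the fundamental group on a trivialised covering. -/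

/-- The left action of the fundamental group on the universal covering by homotopy classes. -/
instance (Γ : KGraph.{u} k) (y : Γ.Ob) : MulAction (Γ.FundamentalGroup y) (ClassOb Γ y) where
  -- The product `g * h` in `End` is `h ≫ g`, so precomposition with `g` itself would be a right
  -- action; the inverse makes it a left action.
  smul g a := ⟨a.pt, Groupoid.inv g ≫ a.cls⟩
  one_smul a := by
    change (⟨a.pt, Groupoid.inv (𝟙 _) ≫ a.cls⟩ : ClassOb Γ y) = a
    simp
  mul_smul g h a := by
    change (⟨a.pt, Groupoid.inv (h ≫ g) ≫ a.cls⟩ : ClassOb Γ y) =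
      ⟨a.pt, Groupoid.inv g ≫ Groupoid.inv h ≫ a.cls⟩
    simp

theorem ClassOb.smul_def {Γ : KGraph.{u} k} {y : Γ.Ob} (g : Γ.FundamentalGroup y)
    (a : ClassOb Γ y) : g • a = ⟨a.pt, Groupoid.inv g ≫ a.cls⟩ := rfl

theorem ClassOb.exists_smul_eq {Γ : KGraph.{u} k} {y : Γ.Ob} {a b : ClassOb Γ y}
    (h : a.pt = b.pt) : ∃ g : Γ.FundamentalGroup y, g • a = b := by
  obtain ⟨v, s⟩ := a
  obtain ⟨w, t⟩ := b
  obtain rfl : v = w := h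
  exact ⟨s ≫ Groupoid.inv t, by rw [smul_def]; simp⟩

theorem ClassOb.eq_one_of_smul_eq {Γ : KGraph.{u} k} {y : Γ.Ob} {g : Γ.FundamentalGroup y}
    {a : ClassOb Γ y} (h : g • a = a) : g = 1 := by
  have h2 : Groupoid.inv g ≫ a.cls = a.cls := eq_of_heq ((ClassOb.mk.injEq ..).mp h).2
  have h3 : Groupoid.inv g = 𝟙 _ := (cancel_mono a.cls).1 (h2.trans (Category.id_comp _).symm)
  exact inv_eq_one.1 (show g⁻¹ = 1 from h3)

/-- The image of a path under the action of an element of the fundamental group. -/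
def ClassOb.smulPath {Γ : KGraph.{u} k} {y : Γ.Ob} (g : Γ.FundamentalGroup y)
    (f : Quiver.Total (ClassOb Γ y)) : Quiver.Total (ClassOb Γ y) :=
  ⟨g • f.left, g • f.right, ClassOb.Hom.mk f.hom.hom
    ((Category.assoc _ _ _).trans (congrArg _ f.hom.comm))⟩

/-- If the fundamental groupoid of `Γ` is trivialised over a covering of `Γ`, then the fundamental
group acts on this covering, freely and transitively on the fibres. -/
theorem IsCovering.exists_mulAction {Ω Γ : KGraph.{u} k} {q : Hom Ω Γ} (hq : IsCovering q)
    {y : Γ.Ob} (t : ∀ v : Ω.Ob, FreeGroupoid.mk y ⟶ FreeGroupoid.mk (q.toFunctor.obj v))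
    (ht : ∀ {v w : Ω.Ob} (f : v ⟶ w), t v ≫ FreeGroupoid.homMk (q.toFunctor.map f) = t w) :
    ∃ _ : MulAction (Γ.FundamentalGroup y) Ω.Ob,
      (∀ v w : Ω.Ob, q.onOb v = q.onOb w → ∃ g : Γ.FundamentalGroup y, g • v = w) ∧
      (∀ (g : Γ.FundamentalGroup y) (v : Ω.Ob), g • v = v → g = 1) ∧
      (∀ (g : Γ.FundamentalGroup y) (f : Ω.Path), ∃ f' : Ω.Path, f'.left = g • f.left ∧
        f'.right = g • f.right ∧ q.onPath f' = q.onPath f) := by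
  -- The bijection on vertices underlies a morphism of `k`-graphs over `Γ`, along which the action
  -- is pulled back.
  let E : Hom Ω (Γ.classGraph y) :=
    ⟨{ obj := fun v => ClassOb.mk (q.onOb v) (t v)
       map := fun f => ClassOb.Hom.mk (q.toFunctor.map f) (ht f)
       map_id := fun v => ClassOb.Hom.ext (q.toFunctor.map_id v)
       map_comp := fun f g => ClassOb.Hom.ext (q.toFunctor.map_comp f g) }, fun f => q.deg_map f⟩
  let e : Ω.Ob ≃ ClassOb Γ y := Equiv.ofBijective _ (hq.bijective_class t ht)
  let _ : MulAction (Γ.FundamentalGroup y) Ω.Ob := e.mulAction _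
  have he : ∀ (g : Γ.FundamentalGroup y) (v : Ω.Ob), e (g • v) = g • e v :=
    fun g v => e.apply_symm_apply _
  refine ⟨inferInstance, ?_, ?_, ?_⟩
  · intro v w h
    obtain ⟨g, hg⟩ := ClassOb.exists_smul_eq (a := e v) (b := e w) h
    exact ⟨g, e.injective (by rw [he, hg])⟩
  · intro g v h
    have h1 : g • e v = e v := by rw [← he, h]
    exact ClassOb.eq_one_of_smul_eq h1
  · intro g f
    have h : q.onOb (g • f.left) = (q.onPath f).left := congrArg ClassOb.pt (he g f.left)
    obtain ⟨f', ⟨h1, h2⟩, -⟩ := hq.existsUnique_from h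
    -- Both paths start at the same vertex and lie over the same path of `Γ`, so they agree.
    -- Comparing their ranges shows that `f'` ends at `g • f.right`.
    have h3 : E.onPath f' = ClassOb.smulPath g (E.onPath f) := by
      refine ClassOb.total_ext_from ?_ h2
      change e f'.left = g • e f.left
      rw [h1, he]
    refine ⟨f', h1, e.injective ?_, h2⟩
    rw [he]
    exact congrArg Quiver.Total.right h3

end KGraph

/-! ### The projection to the quotient by `∼` as a covering. -/

namespace RepKGraph

open KGraph

variable {k : ℕ} {Λ : KGraph.{u} k}

/-- The projection from `Δ` to its quotient by `∼`. -/
def quotientProj (X : RepKGraph Λ) : KGraph.Hom X.graph X.quotient.graph where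
  toFunctor := X.qFunctor
  deg_map _ := rfl

theorem quotientProj_onPath_eq {X : RepKGraph Λ} {f g : X.graph.Path}
    (h : X.quotientProj.onPath f = X.quotientProj.onPath g) : X.pathSetoid f g := by
  refine X.qPath_eq.1 ?_
  exact congrArg (fun f : X.quotient.graph.Path => QPath.ofHom (X := X) f.hom) h

/-- The projection from a representation `k`-graph to its quotient is a covering. -/
theorem isCovering_quotientProj (X : RepKGraph Λ) : IsCovering X.quotientProj := by
  intro v
  refine ⟨⟨?_, ?_, ?_⟩, ?_, ?_, ?_⟩
  · rintro f rfl; rfl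
  · intro f hf g hg e
    exact X.path_eq_of_left (Eq.trans hf (Eq.symm hg)) (quotientProj_onPath_eq e).2
  · intro f hf
    obtain ⟨g, hg, e⟩ := (QPath.ofHom (X := X) f.hom).exists_rep_from v
      ((QPath.ofHom_src _).trans hf)
    exact ⟨g, hg, QPath.total_ext e⟩
  · rintro f rfl; rfl
  · intro f hf g hg e
    exact X.path_eq_of_right (Eq.trans hf (Eq.symm hg)) (quotientProj_onPath_eq e).2
  · intro f hf
    obtain ⟨g, hg, e⟩ := (QPath.ofHom (X := X) f.hom).exists_rep_to v
      ((QPath.ofHom_tgt _).trans hf)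
    exact ⟨g, hg, QPath.total_ext e⟩

/-- The relation `∼` on paths compares only the class of the source and the label. This reduces the
functoriality of `toQuotient` to equalities of sources and of labels in `Λ`. -/
theorem QPath.ext_label {X : RepKGraph Λ} {m n : X.QPath} (h : m.src = n.src)
    (e : m.label = n.label) : m = n := by
  obtain ⟨f, rfl⟩ := m.exists_rep
  obtain ⟨g, hg, rfl⟩ := n.exists_rep_from f.left h.symm
  exact X.qPath_eq.2 ⟨by rw [hg], e⟩

theorem QPath.comp_label {X : RepKGraph Λ} (m n : X.QPath) (h : m.tgt = n.src) :
    (m.comp n h).label =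
      compPath m.label n.label (by rw [label_right, label_left, h]) := by
  obtain ⟨f, rfl⟩ := m.exists_rep
  obtain ⟨g, hg, rfl⟩ := n.exists_rep_from f.right h.symm
  rw [QPath.comp_mk f g hg.symm]
  exact X.hom.onPath_compPath f g hg.symm

/-! ### The factorisation of `Ω → Γ` through `Δ`, and the trivialisation over `Ω`. -/

section ofCovering

variable (X : RepKGraph Λ) {Ω : KGraph.{u} k} (τ : KGraph.Hom Ω X.graph) (hτ : IsCovering τ)

theorem tgt_onEdge {Ω Δ : KGraph.{u} k} (τ : KGraph.Hom Ω Δ) (e : Ω.Edge) :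
    (τ.onEdge e).tgt = τ.onOb e.tgt := by
  cases e <;> rfl

theorem exists_edge_lift {Ω Δ : KGraph.{u} k} {τ : KGraph.Hom Ω Δ} (hτ : IsCovering τ)
    (e : Ω.Edge) {v : Ω.Ob} (h : τ.onOb e.src = τ.onOb v) :
    ∃ e' : Ω.Edge, e'.src = v ∧ τ.onEdge e' = τ.onEdge e := by
  cases e with
  | fwd f =>
    obtain ⟨g, ⟨hg, e⟩, -⟩ := hτ.existsUnique_from (f := τ.onPath f) h.symm
    exact ⟨.fwd g, hg, congrArg Edge.fwd e⟩
  | rev f hf =>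
    obtain ⟨g, ⟨hg, e⟩, -⟩ := hτ.existsUnique_to (f := τ.onPath f) h.symm
    refine ⟨.rev g ?_, hg, (Edge.rev.injEq ..).mpr e⟩
    rintro ⟨w, rfl⟩
    exact hf (τ.isIdPath_of_onPath ⟨_, e.symm.trans (τ.onPath_idPath w)⟩)

/-- Edges are lifted one at a time: forward edges by their source, reversed edges by their range. -/
theorem exists_walk_lift {Ω Δ : KGraph.{u} k} {τ : KGraph.Hom Ω Δ} (hτ : IsCovering τ)
    (p : List Ω.Edge) {u v : Ω.Ob} (h : τ.onOb u = τ.onOb v) (hp : Ω.ChainFrom u p) :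
    ∃ p', Ω.ChainFrom v p' ∧ τ.onWalk p' = τ.onWalk p := by
  induction p generalizing u v with
  | nil => exact ⟨[], trivial, rfl⟩
  | cons e l ih =>
    obtain ⟨rfl, hl⟩ := hp
    obtain ⟨e', rfl, he⟩ := exists_edge_lift hτ e h
    obtain ⟨l', hl', hw⟩ := ih (v := e'.tgt) (by rw [← tgt_onEdge, ← he, tgt_onEdge]) hl
    exact ⟨e' :: l', ⟨rfl, hl'⟩, congrArg₂ List.cons he hw⟩

variable {X τ}

theorem obSetoid_ofCovering_aux {u v : Ω.Ob} (h : τ.onOb u = τ.onOb v) :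
    (X.ofCovering τ hτ).walkImage u ⊆ (X.ofCovering τ hτ).walkImage v := by
  rintro _ ⟨p, ⟨hp0, hp⟩, rfl⟩
  obtain ⟨p', hp', e⟩ := exists_walk_lift hτ p h hp
  refine ⟨p', ⟨?_, hp'⟩, ?_⟩
  · rintro rfl
    exact hp0 (List.map_eq_nil_iff.1 e.symm)
  · have key : ∀ p : List Ω.Edge,
        (X.ofCovering τ hτ).hom.onWalk p = X.hom.onWalk (τ.onWalk p) := by
      intro p
      refine Eq.trans (List.map_congr_left fun e _ => ?_) (List.map_map ..).symm
      cases e <;> rfl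
    exact (key p').trans ((congrArg X.hom.onWalk e).trans (key p).symm)

/-- Vertices of a covering of `Δ` with the same image in `Δ` are equivalent. -/
theorem obSetoid_ofCovering {u v : Ω.Ob} (h : τ.onOb u = τ.onOb v) :
    (X.ofCovering τ hτ).obSetoid u v :=
  (obSetoid_ofCovering_aux hτ h).antisymm (obSetoid_ofCovering_aux hτ h.symm)

/-- The lift of `f` from the chosen preimage of `a` need not end at the chosen preimage of `b`, but
the two vertices have the same image in `Δ` and hence the same class. -/
theorem exists_path_ofCovering {a b : X.graph.Ob} (f : a ⟶ b) :
    ∃ m : (X.ofCovering τ hτ).QPath,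
      m.src = (X.ofCovering τ hτ).qOb (Function.surjInv hτ.surjective_onOb a) ∧
      m.tgt = (X.ofCovering τ hτ).qOb (Function.surjInv hτ.surjective_onOb b) ∧
      m.label = X.hom.onPath ⟨a, b, f⟩ := by
  obtain ⟨g, ⟨h1, h2⟩, -⟩ := hτ.existsUnique_from (f := ⟨a, b, f⟩)
    (Function.surjInv_eq hτ.surjective_onOb a)
  refine ⟨(X.ofCovering τ hτ).qPath g, congrArg (X.ofCovering τ hτ).qOb h1,
    (X.ofCovering τ hτ).qOb_eq.2 (obSetoid_ofCovering hτ ?_), congrArg X.hom.onPath h2⟩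
  exact (congrArg Quiver.Total.right h2).trans (Function.surjInv_eq hτ.surjective_onOb b).symm

/-- The functor from `Δ` to the quotient by `∼` of a covering of `Δ`. -/
def toQuotient : X.graph.Ob ⥤ (X.ofCovering τ hτ).QOb where
  obj a := (X.ofCovering τ hτ).qOb (Function.surjInv hτ.surjective_onOb a)
  map f := QHom.of (exists_path_ofCovering hτ f).choose
    (exists_path_ofCovering hτ f).choose_spec.1 (exists_path_ofCovering hτ f).choose_spec.2.1
  map_id a := by
    have h := (exists_path_ofCovering hτ (𝟙 a)).choose_spec
    refine QHom.ext (QPath.ext_label (h.1.trans (QOb.idPath_src _).symm) (h.2.2.trans ?_))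
    refine Eq.trans ?_ ((X.ofCovering τ hτ).hom.onPath_idPath
      (Function.surjInv hτ.surjective_onOb a)).symm
    exact (X.hom.onPath_idPath a).trans (congrArg (fun w => Λ.idPath (X.hom.onOb w))
      (Function.surjInv_eq hτ.surjective_onOb a).symm)
  map_comp {a b c} f g := by
    have hf := (exists_path_ofCovering hτ f).choose_spec
    have hg := (exists_path_ofCovering hτ g).choose_spec
    have h := (exists_path_ofCovering hτ (f ≫ g)).choose_spec
    refine QHom.ext (QPath.ext_label ?_ ?_)
    · exact (h.1.trans hf.1.symm).trans
        (QPath.comp_src _ _ (hf.2.1.trans hg.1.symm)).symm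
    · refine Eq.trans ?_ (QPath.comp_label _ _ (hf.2.1.trans hg.1.symm)).symm
      refine h.2.2.trans ?_
      rw [← compPath_mk, X.hom.onPath_compPath]
      exact compPath_congr hf.2.2.symm hg.2.2.symm _ _

theorem toQuotient_obj (v : Ω.Ob) :
    (toQuotient hτ).obj (τ.toFunctor.obj v) = (X.ofCovering τ hτ).qFunctor.obj v :=
  (X.ofCovering τ hτ).qOb_eq.2 (obSetoid_ofCovering hτ (Function.surjInv_eq _ _))

/-- The two morphisms have different endpoint expressions, equal only through `toQuotient_obj`, so
the underlying classes of paths are compared instead. -/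
theorem toQuotient_map {v w : Ω.Ob} (f : v ⟶ w) :
    QPath.ofHom ((toQuotient hτ).map (τ.toFunctor.map f)) =
      QPath.ofHom ((X.ofCovering τ hτ).qFunctor.map f) := by
  have h := (exists_path_ofCovering hτ (τ.toFunctor.map f)).choose_spec
  exact QPath.ext_label (h.1.trans (toQuotient_obj hτ v)) h.2.2

/-- Turns an equality of underlying classes, as in `toQuotient_map`, into a commuting square in the
fundamental groupoid. -/
theorem homMk_comp_eqToHom {A A' B B' : X.QOb} (hA : A = A') (hB : B = B') (m : A ⟶ B)
    (m' : A' ⟶ B') (h : QPath.ofHom m = QPath.ofHom m') :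
    FreeGroupoid.homMk m ≫ eqToHom (congrArg FreeGroupoid.mk hB) =
      eqToHom (congrArg FreeGroupoid.mk hA) ≫ FreeGroupoid.homMk m' := by
  subst hA hB
  obtain rfl : m = m' := QHom.ext h
  rw [eqToHom_refl, eqToHom_refl, Category.comp_id, Category.id_comp]

/-- The fundamental groupoid of the quotient by `∼` of a universal covering `Ω` of `Δ` is
trivialised over `Ω`. -/
theorem exists_trivialisation (hτ : IsUniversalCovering τ)
    (y : (X.ofCovering τ hτ.1).quotient.graph.Ob) :
    ∃ t : ∀ v : Ω.Ob, FreeGroupoid.mk y ⟶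
        FreeGroupoid.mk ((X.ofCovering τ hτ.1).quotientProj.toFunctor.obj v),
      ∀ {v w : Ω.Ob} (f : v ⟶ w), t v ≫ FreeGroupoid.homMk
        ((X.ofCovering τ hτ.1).quotientProj.toFunctor.map f) = t w := by
  obtain ⟨v₀, hv₀⟩ := (X.ofCovering τ hτ.1).isCovering_quotientProj.surjective_onOb y
  -- The base vertex in `Δ` is the image of a vertex over `y`, so that `toQuotient` sends it to `y`.
  obtain ⟨g, hg⟩ := hτ.exists_trivialisation (τ.toFunctor.obj v₀)
  have e₀ : y = (toQuotient hτ.1).obj (τ.toFunctor.obj v₀) :=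
    hv₀.symm.trans (toQuotient_obj hτ.1 v₀).symm
  refine ⟨fun v => eqToHom (congrArg FreeGroupoid.mk e₀) ≫
    (FreeGroupoid.map (toQuotient hτ.1)).map (g v) ≫
      eqToHom (congrArg FreeGroupoid.mk (toQuotient_obj hτ.1 v)), fun {v w} f => ?_⟩
  have h := homMk_comp_eqToHom (toQuotient_obj hτ.1 v) (toQuotient_obj hτ.1 w) _ _
    (toQuotient_map hτ.1 f)
  have h' : (FreeGroupoid.map (toQuotient hτ.1)).map (g v) ≫
      FreeGroupoid.homMk ((toQuotient hτ.1).map (τ.toFunctor.map f)) =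
      (FreeGroupoid.map (toQuotient hτ.1)).map (g w) := by
    rw [← hg f, Functor.map_comp]
    rfl
  refine Eq.trans ?_ (congrArg (fun c => eqToHom (congrArg FreeGroupoid.mk e₀) ≫ c ≫
    eqToHom (congrArg FreeGroupoid.mk (toQuotient_obj hτ.1 w))) h')
  refine (Category.assoc _ _ _).trans (congrArg (eqToHom _ ≫ ·) ?_)
  refine (Category.assoc _ _ _).trans (Eq.trans ?_ (Category.assoc _ _ _).symm)
  exact congrArg ((FreeGroupoid.map (toQuotient hτ.1)).map (g v) ≫ ·) h.symm

end ofCovering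

end RepKGraph

namespace RepKGraph

open KGraph

variable {k : ℕ} {Λ : KGraph.{u} k} (K : Type*) [Field K] (X : RepKGraph Λ)

/-! ### Coefficients of the generators -/

/-- A lift of a path of `Λ` is determined by its source and also by its range. So `δ.left` is the
only basis vertex that contributes to the coefficient at `δ.right`. -/
theorem sigma_apply_right (δ : X.graph.Path) (x : X.V K) :
    X.sigma K (X.hom.onPath δ) x δ.right = x δ.left := by
  induction x using Finsupp.induction_linear with
  | zero => simp
  | add x y hx hy => rw [map_add, Finsupp.add_apply, Finsupp.add_apply, hx, hy]
  | single w c =>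
    classical
    rw [← Finsupp.smul_single_one, map_smul, Finsupp.smul_apply, Finsupp.smul_apply]
    congr 1
    by_cases h : ∃ ε : X.graph.Path, ε.left = w ∧ X.hom.onPath ε = X.hom.onPath δ
    · obtain ⟨ε, rfl, hε⟩ := h
      rw [X.sigma_of K ε rfl hε, Finsupp.single_apply, Finsupp.single_apply]
      refine if_congr ⟨fun h => ?_, fun h => ?_⟩ rfl rfl
      · rw [X.path_eq_of_right h hε]
      · rw [X.path_eq_of_left h hε]
    · rw [X.sigma_zero K h, Finsupp.single_apply, if_neg, Finsupp.coe_zero, Pi.zero_apply]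
      rintro rfl
      exact h ⟨δ, rfl, rfl⟩

theorem sigma_apply_eq_zero {v : X.graph.Ob} {f : Λ.Path}
    (h : ¬ ∃ δ : X.graph.Path, δ.right = v ∧ X.hom.onPath δ = f) (x : X.V K) :
    X.sigma K f x v = 0 := by
  induction x using Finsupp.induction_linear with
  | zero => simp
  | add x y hx hy => rw [map_add, Finsupp.add_apply, hx, hy, add_zero]
  | single w c =>
    classical
    rw [← Finsupp.smul_single_one, map_smul, Finsupp.smul_apply]
    by_cases h' : ∃ ε : X.graph.Path, ε.left = w ∧ X.hom.onPath ε = f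
    · obtain ⟨ε, rfl, hε⟩ := h'
      rw [X.sigma_of K ε rfl hε, Finsupp.single_apply, if_neg, smul_zero]
      exact fun h' => h ⟨ε, h', hε⟩
    · rw [X.sigma_zero K h', Finsupp.coe_zero, Pi.zero_apply, smul_zero]

theorem sigmaStar_apply_left (δ : X.graph.Path) (x : X.V K) :
    X.sigmaStar K (X.hom.onPath δ) x δ.left = x δ.right := by
  induction x using Finsupp.induction_linear with
  | zero => simp
  | add x y hx hy => rw [map_add, Finsupp.add_apply, Finsupp.add_apply, hx, hy]
  | single w c =>
    classical
    rw [← Finsupp.smul_single_one, map_smul, Finsupp.smul_apply, Finsupp.smul_apply]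
    congr 1
    by_cases h : ∃ ε : X.graph.Path, ε.right = w ∧ X.hom.onPath ε = X.hom.onPath δ
    · obtain ⟨ε, rfl, hε⟩ := h
      rw [X.sigmaStar_of K ε rfl hε, Finsupp.single_apply, Finsupp.single_apply]
      refine if_congr ⟨fun h => ?_, fun h => ?_⟩ rfl rfl
      · rw [X.path_eq_of_left h hε]
      · rw [X.path_eq_of_right h hε]
    · rw [X.sigmaStar_zero K h, Finsupp.single_apply, if_neg, Finsupp.coe_zero, Pi.zero_apply]
      rintro rfl
      exact h ⟨δ, rfl, rfl⟩

theorem sigmaStar_apply_eq_zero {v : X.graph.Ob} {f : Λ.Path}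
    (h : ¬ ∃ δ : X.graph.Path, δ.left = v ∧ X.hom.onPath δ = f) (x : X.V K) :
    X.sigmaStar K f x v = 0 := by
  induction x using Finsupp.induction_linear with
  | zero => simp
  | add x y hx hy => rw [map_add, Finsupp.add_apply, hx, hy, add_zero]
  | single w c =>
    classical
    rw [← Finsupp.smul_single_one, map_smul, Finsupp.smul_apply]
    by_cases h' : ∃ ε : X.graph.Path, ε.right = w ∧ X.hom.onPath ε = f
    · obtain ⟨ε, rfl, hε⟩ := h'
      rw [X.sigmaStar_of K ε rfl hε, Finsupp.single_apply, if_neg, smul_zero]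
      exact fun h' => h ⟨ε, h', hε⟩
    · rw [X.sigmaStar_zero K h', Finsupp.coe_zero, Pi.zero_apply, smul_zero]

/-! ### The operators of the edges -/

/-- The endomorphism given by an edge: `σ_f` for `f` and `σ_{f*}` for the reversed edge `f*`. -/
def edgeOp : Λ.Edge → Module.End K (X.V K)
  | .fwd f => X.sigma K f
  | .rev f _ => X.sigmaStar K f

/-- The endomorphism given by the reverse of an edge. -/
def edgeOpInv : Λ.Edge → Module.End K (X.V K)
  | .fwd f => X.sigmaStar K f
  | .rev f _ => X.sigma K f

theorem edgeOp_src (d : X.graph.Edge) :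
    X.edgeOp K (X.hom.onEdge d) (vtx K d.src) = vtx K d.tgt := by
  cases d with
  | fwd f => exact X.sigma_of K f rfl rfl
  | rev f hf => exact X.sigmaStar_of K f rfl rfl

theorem edgeOpInv_tgt (d : X.graph.Edge) :
    X.edgeOpInv K (X.hom.onEdge d) (vtx K d.tgt) = vtx K d.src := by
  cases d with
  | fwd f => exact X.sigmaStar_of K f rfl rfl
  | rev f hf => exact X.sigma_of K f rfl rfl

theorem exists_rev_of_right {v : X.graph.Ob} {f : Λ.Path} (hf : ¬ Λ.IsIdPath f)
    (h : ∃ δ : X.graph.Path, δ.right = v ∧ X.hom.onPath δ = f) :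
    ∃ d : X.graph.Edge, d.src = v ∧ X.hom.onEdge d = .rev f hf := by
  obtain ⟨δ, rfl, rfl⟩ := h
  refine ⟨.rev δ ?_, rfl, rfl⟩
  rintro ⟨w, rfl⟩
  exact hf ⟨_, X.hom.onPath_idPath w⟩

theorem edgeOp_eq_zero {v : X.graph.Ob} {e : Λ.Edge}
    (h : ¬ ∃ d : X.graph.Edge, d.src = v ∧ X.hom.onEdge d = e) :
    X.edgeOp K e (vtx K v) = 0 := by
  cases e with
  | fwd f =>
    refine X.sigma_zero K fun h' => h ?_
    obtain ⟨δ, h1, h2⟩ := h'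
    exact ⟨.fwd δ, h1, congrArg Edge.fwd h2⟩
  | rev f hf => exact X.sigmaStar_zero K fun h' => h (X.exists_rev_of_right hf h')

theorem edgeOp_apply_tgt (d : X.graph.Edge) (x : X.V K) :
    X.edgeOp K (X.hom.onEdge d) x d.tgt = x d.src := by
  cases d with
  | fwd f => exact X.sigma_apply_right K f x
  | rev f hf => exact X.sigmaStar_apply_left K f x

theorem edgeOpInv_apply_eq_zero {v : X.graph.Ob} {e : Λ.Edge}
    (h : ¬ ∃ d : X.graph.Edge, d.src = v ∧ X.hom.onEdge d = e) (x : X.V K) :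
    X.edgeOpInv K e x v = 0 := by
  cases e with
  | fwd f =>
    refine X.sigmaStar_apply_eq_zero K (fun h' => h ?_) x
    obtain ⟨δ, h1, h2⟩ := h'
    exact ⟨.fwd δ, h1, congrArg Edge.fwd h2⟩
  | rev f hf => exact X.sigma_apply_eq_zero K (fun h' => h (X.exists_rev_of_right hf h')) x

/-! ### Endomorphisms -/

/-- An endomorphism of the vector space `V_(Δ,α)` which commutes with the generators of the
Kumjian-Pask algebra. -/
structure IsEquivariant (T : Module.End K (X.V K)) : Prop where
  sigma : ∀ f : Λ.Path, Commute T (X.sigma K f)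
  sigmaStar : ∀ f : Λ.Path, Commute T (X.sigmaStar K f)

variable {K X}

/-- `KP(Λ)` is spanned by products of generators. -/
theorem IsEquivariant.commute_action {T : Module.End K (X.V K)} (hT : X.IsEquivariant K T)
    (a : KP K Λ) : Commute T (X.action K a) := by
  obtain ⟨x, rfl⟩ := Quot.exists_rep a
  change Commute T (X.freeAction K x)
  have key : ∀ s : FreeSemigroup Λ.KPGen,
      Commute T (X.freeAction K (MonoidAlgebra.single s 1)) := by
    intro s
    induction s using FreeSemigroup.recOnMul with
    | ih1 x =>
      change Commute T (X.freeAction K (kpGen K x))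
      rw [freeAction_kpGen]
      cases x with
      | path f => exact hT.sigma f
      | ghost f hf => exact hT.sigmaStar f
    | ih2 x y hx hy =>
      rw [← one_mul (1 : K), ← MonoidAlgebra.single_mul_single, map_mul]
      exact hx.mul_right hy
  induction x using MonoidAlgebra.induction_linear with
  | zero => rw [map_zero]; exact Commute.zero_right T
  | add x y hx hy => rw [map_add]; exact hx.add_right hy
  | single s r =>
    rw [← mul_one r, ← smul_eq_mul, ← MonoidAlgebra.smul_single, map_smul]
    exact (key s).smul_right r

theorem IsEquivariant.of_commute_action {T : Module.End K (X.V K)}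
    (h : ∀ a : KP K Λ, Commute T (X.action K a)) : X.IsEquivariant K T where
  sigma f := by
    rw [← freeAction_kpPath]
    exact h (KP.mk (kpPath K f))
  sigmaStar f := by
    rw [← freeAction_kpStar]
    exact h (KP.mk (kpStar K f))

theorem IsEquivariant.sub {T T' : Module.End K (X.V K)} (h : X.IsEquivariant K T)
    (h' : X.IsEquivariant K T') : X.IsEquivariant K (T - T') :=
  ⟨fun f => Commute.sub_left (R := Module.End K (X.V K)) (h.sigma f) (h'.sigma f),
    fun f => Commute.sub_left (R := Module.End K (X.V K)) (h.sigmaStar f) (h'.sigmaStar f)⟩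

theorem IsEquivariant.edgeOp_apply {T : Module.End K (X.V K)} (h : X.IsEquivariant K T)
    (e : Λ.Edge) (x : X.V K) : T (X.edgeOp K e x) = X.edgeOp K e (T x) := by
  cases e with
  | fwd f => exact LinearMap.congr_fun (h.sigma f).eq x
  | rev f hf => exact LinearMap.congr_fun (h.sigmaStar f).eq x

theorem IsEquivariant.edgeOpInv_apply {T : Module.End K (X.V K)} (h : X.IsEquivariant K T)
    (e : Λ.Edge) (x : X.V K) : T (X.edgeOpInv K e x) = X.edgeOpInv K e (T x) := by
  cases e with
  | fwd f => exact LinearMap.congr_fun (h.sigmaStar f).eq x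
  | rev f hf => exact LinearMap.congr_fun (h.sigma f).eq x

/-- The vertex `d.src` is the image of `d.tgt` under the reverse operator, so its image under `T`
lies in the range of that operator. Elements of this range are supported on vertices where an edge
with the same image as `d` starts. -/
theorem IsEquivariant.exists_edge_of_src {T : Module.End K (X.V K)} (h : X.IsEquivariant K T)
    (d : X.graph.Edge) {v : X.graph.Ob} (hv : T (vtx K d.src) v ≠ 0) :
    ∃ d' : X.graph.Edge, d'.src = v ∧ X.hom.onEdge d' = X.hom.onEdge d := by
  by_contra hd
  apply hv
  rw [← edgeOpInv_tgt, h.edgeOpInv_apply]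
  exact X.edgeOpInv_apply_eq_zero K hd _

/-- If no such edge starts at `u`, the edge operator kills `u` and hence `T u`; but it carries the
coefficient at `d.src` to the one at `d.tgt`. -/
theorem IsEquivariant.exists_edge_of_coeff {T : Module.End K (X.V K)} (h : X.IsEquivariant K T)
    (d : X.graph.Edge) {u : X.graph.Ob} (hu : T (vtx K u) d.src ≠ 0) :
    ∃ d' : X.graph.Edge, d'.src = u ∧ X.hom.onEdge d' = X.hom.onEdge d := by
  by_contra hd
  apply hu
  rw [← edgeOp_apply_tgt, ← h.edgeOp_apply, X.edgeOp_eq_zero K hd, map_zero, Finsupp.coe_zero,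
    Pi.zero_apply]

/-- Matrix coefficients are constant along pairs of edges with the same image, which drives the
induction on walks below. -/
theorem IsEquivariant.apply_tgt {T : Module.End K (X.V K)} (h : X.IsEquivariant K T)
    (d d' : X.graph.Edge) (hd : X.hom.onEdge d' = X.hom.onEdge d) :
    T (vtx K d.tgt) d'.tgt = T (vtx K d.src) d'.src := by
  rw [← edgeOp_src, h.edgeOp_apply, ← hd, edgeOp_apply_tgt]

/-- The coefficients of an equivariant endomorphism are supported on the relation `∼`. -/
theorem IsEquivariant.obSetoid_of_apply_ne_zero {T : Module.End K (X.V K)}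
    (h : X.IsEquivariant K T) {u v : X.graph.Ob} (huv : T (vtx K u) v ≠ 0) :
    X.obSetoid u v := by
  refine Set.Subset.antisymm ?_ ?_
  · rintro _ ⟨p, ⟨hp0, hp⟩, rfl⟩
    -- The induction allows the empty walk; nonemptiness is restored afterwards.
    have key : ∀ (p : List X.graph.Edge) (u v : X.graph.Ob), T (vtx K u) v ≠ 0 →
        X.graph.ChainFrom u p → ∃ p', X.graph.ChainFrom v p' ∧
          X.hom.onWalk p' = X.hom.onWalk p := by
      intro p
      induction p with
      | nil => exact fun u v _ _ => ⟨[], trivial, rfl⟩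
      | cons d l ih =>
        rintro _ v huv ⟨rfl, hl⟩
        obtain ⟨d', rfl, hd⟩ := h.exists_edge_of_src d huv
        rw [← h.apply_tgt d d' hd] at huv
        obtain ⟨l', hl', e⟩ := ih _ _ huv hl
        exact ⟨d' :: l', ⟨rfl, hl'⟩, congrArg₂ List.cons hd e⟩
    obtain ⟨p', hp', e⟩ := key p u v huv hp
    refine ⟨p', ⟨?_, hp'⟩, e⟩
    rintro rfl
    exact hp0 (List.map_eq_nil_iff.1 e.symm)
  · rintro _ ⟨p, ⟨hp0, hp⟩, rfl⟩
    -- The hypothesis on `T` is not symmetric in `u` and `v`, so the reverse inclusion needs its own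
    -- lifting lemma, `exists_edge_of_coeff`.
    have key : ∀ (p : List X.graph.Edge) (u v : X.graph.Ob), T (vtx K u) v ≠ 0 →
        X.graph.ChainFrom v p → ∃ p', X.graph.ChainFrom u p' ∧
          X.hom.onWalk p' = X.hom.onWalk p := by
      intro p
      induction p with
      | nil => exact fun u v _ _ => ⟨[], trivial, rfl⟩
      | cons d l ih =>
        rintro u _ huv ⟨rfl, hl⟩
        obtain ⟨d', rfl, hd⟩ := h.exists_edge_of_coeff d huv
        rw [← h.apply_tgt d' d hd.symm] at huv
        obtain ⟨l', hl', e⟩ := ih _ _ huv hl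
        exact ⟨d' :: l', ⟨rfl, hl'⟩, congrArg₂ List.cons hd e⟩
    obtain ⟨p', hp', e⟩ := key p u v huv hp
    refine ⟨p', ⟨?_, hp'⟩, e⟩
    rintro rfl
    exact hp0 (List.map_eq_nil_iff.1 e.symm)

/-- An equivariant endomorphism which kills a vertex is zero. -/
theorem IsEquivariant.eq_zero {T : Module.End K (X.V K)} (h : X.IsEquivariant K T)
    {u : X.graph.Ob} (hu : T (vtx K u) = 0) : T = 0 := by
  -- Each end of a path is the image of the other under an edge operator or its reverse, so the
  -- property of being killed spreads over the connected graph.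
  refine X.end_ext K (X.graph.induct_on_vertices (fun v => T (vtx K v) = 0) hu fun f => ⟨?_, ?_⟩)
  · intro hf
    have := h.edgeOp_apply (X.hom.onEdge (.fwd f)) (vtx K f.left)
    rw [hf, map_zero] at this
    exact (congrArg T (X.edgeOp_src K (.fwd f)).symm).trans this
  · intro hf
    have := h.edgeOpInv_apply (X.hom.onEdge (.fwd f)) (vtx K f.right)
    rw [hf, map_zero] at this
    exact (congrArg T (X.edgeOpInv_tgt K (.fwd f)).symm).trans this

/-! ### The group algebra as the algebra of equivariant endomorphisms. -/

section groupAction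

variable (K X) {G : Type*} [Group G] [MulAction G X.graph.Ob]

/-- The permutation representation on `V_(Δ,α)` of a group acting on the vertices of `Δ`. -/
def permRep : G →* Module.End K (X.V K) where
  toFun g := Finsupp.lmapDomain K K (g • ·)
  map_one' := X.end_ext K fun v => by simp
  map_mul' g h := X.end_ext K fun v => by simp [mul_smul]

theorem permRep_vtx (g : G) (v : X.graph.Ob) :
    X.permRep K g (vtx K v) = vtx K (g • v) := by
  simp [permRep]

/-- The action of the group algebra on `V_(Δ,α)` for a group acting on the vertices of `Δ`. -/
def groupAlgebraHom : MonoidAlgebra K G →ₐ[K] Module.End K (X.V K) :=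
  MonoidAlgebra.lift K (Module.End K (X.V K)) G (X.permRep K)

theorem groupAlgebraHom_single (g : G) (c : K) :
    X.groupAlgebraHom K (MonoidAlgebra.single g c) = c • X.permRep K g := by
  rw [groupAlgebraHom, MonoidAlgebra.lift_single]

variable {K X}

/-- By freeness only `g` itself moves `v` to `g • v`, so coefficients in the group algebra can be
read off from a single vertex. -/
theorem groupAlgebraHom_apply (hfree : ∀ (g : G) (v : X.graph.Ob), g • v = v → g = 1)
    (x : MonoidAlgebra K G) (v : X.graph.Ob) (g : G) :
    X.groupAlgebraHom K x (vtx K v) (g • v) = x.coeff g := by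
  classical
  induction x using MonoidAlgebra.induction_linear with
  | zero => simp
  | add x y hx hy =>
    rw [map_add, LinearMap.add_apply, Finsupp.add_apply, hx, hy, MonoidAlgebra.coeff_add,
      Finsupp.add_apply]
  | single h c =>
    rw [groupAlgebraHom_single, LinearMap.smul_apply, permRep_vtx, Finsupp.smul_apply,
      MonoidAlgebra.coeff_single, Finsupp.single_apply, Finsupp.single_apply]
    have : h • v = g • v ↔ h = g := by
      refine ⟨fun e => ?_, fun e => by rw [e]⟩
      have := hfree (g⁻¹ * h) v (by rw [mul_smul, e, inv_smul_smul])
      exact (inv_mul_eq_one.1 this).symm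
    rw [if_congr this rfl rfl, smul_ite, smul_zero, smul_eq_mul, mul_one]

theorem groupAlgebraHom_injective (hfree : ∀ (g : G) (v : X.graph.Ob), g • v = v → g = 1) :
    Function.Injective (X.groupAlgebraHom K (G := G)) := by
  obtain ⟨v⟩ := X.graph.connected.is_nonempty
  intro x y h
  refine MonoidAlgebra.ext (Finsupp.ext fun g => ?_)
  rw [← groupAlgebraHom_apply hfree x v g, h, groupAlgebraHom_apply hfree]

/-- Translation by `g` carries lifts of `f` to lifts of `f`; translation by `g⁻¹` shows that no lift
appears at `g • v` if there was none at `v`. -/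
theorem isEquivariant_permRep
    (hpath : ∀ (g : G) (f : X.graph.Path), ∃ f' : X.graph.Path, f'.left = g • f.left ∧
      f'.right = g • f.right ∧ X.hom.onPath f' = X.hom.onPath f) (g : G) :
    X.IsEquivariant K (X.permRep K g) where
  sigma f := X.end_ext K fun v => by
    rw [Module.End.mul_apply, Module.End.mul_apply, permRep_vtx]
    by_cases h : ∃ δ : X.graph.Path, δ.left = v ∧ X.hom.onPath δ = f
    · obtain ⟨δ, rfl, rfl⟩ := h
      obtain ⟨δ', h1, h2, h3⟩ := hpath g δ
      rw [X.sigma_of K δ rfl rfl, X.sigma_of K δ' h1 h3, permRep_vtx, h2]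
    · rw [X.sigma_zero K h, map_zero, X.sigma_zero K]
      rintro ⟨δ, h1, h2⟩
      obtain ⟨δ', h1', -, h3⟩ := hpath g⁻¹ δ
      exact h ⟨δ', by rw [h1', h1, inv_smul_smul], h3.trans h2⟩
  sigmaStar f := X.end_ext K fun v => by
    rw [Module.End.mul_apply, Module.End.mul_apply, permRep_vtx]
    by_cases h : ∃ δ : X.graph.Path, δ.right = v ∧ X.hom.onPath δ = f
    · obtain ⟨δ, rfl, rfl⟩ := h
      obtain ⟨δ', h1, h2, h3⟩ := hpath g δ
      rw [X.sigmaStar_of K δ rfl rfl, X.sigmaStar_of K δ' h2 h3, permRep_vtx, h1]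
    · rw [X.sigmaStar_zero K h, map_zero, X.sigmaStar_zero K]
      rintro ⟨δ, h1, h2⟩
      obtain ⟨δ', -, h1', h3⟩ := hpath g⁻¹ δ
      exact h ⟨δ', by rw [h1', h1, inv_smul_smul], h3.trans h2⟩

theorem isEquivariant_groupAlgebraHom
    (hpath : ∀ (g : G) (f : X.graph.Path), ∃ f' : X.graph.Path, f'.left = g • f.left ∧
      f'.right = g • f.right ∧ X.hom.onPath f' = X.hom.onPath f) (x : MonoidAlgebra K G) :
    X.IsEquivariant K (X.groupAlgebraHom K x) := by
  induction x using MonoidAlgebra.induction_linear with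
  | zero => rw [map_zero]; exact ⟨fun _ => Commute.zero_left _, fun _ => Commute.zero_left _⟩
  | add x y hx hy =>
    rw [map_add]
    exact ⟨fun f => (hx.sigma f).add_left (hy.sigma f),
      fun f => (hx.sigmaStar f).add_left (hy.sigmaStar f)⟩
  | single g c =>
    rw [groupAlgebraHom_single]
    have h := isEquivariant_permRep (K := K) hpath g
    exact ⟨fun f => (h.sigma f).smul_left c, fun f => (h.sigmaStar f).smul_left c⟩

/-- If a group acts on `Δ` over `Λ` such that the classes of `∼` are contained in the orbits, then
every equivariant endomorphism of `V_(Δ,α)` comes from the group algebra. -/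
theorem IsEquivariant.exists_groupAlgebraHom_eq
    (htrans : ∀ v w : X.graph.Ob, X.obSetoid v w → ∃ g : G, g • v = w)
    (hpath : ∀ (g : G) (f : X.graph.Path), ∃ f' : X.graph.Path, f'.left = g • f.left ∧
      f'.right = g • f.right ∧ X.hom.onPath f' = X.hom.onPath f)
    {T : Module.End K (X.V K)} (hT : X.IsEquivariant K T) :
    ∃ x : MonoidAlgebra K G, X.groupAlgebraHom K x = T := by
  obtain ⟨u⟩ := X.graph.connected.is_nonempty
  have h : ∀ v, ∃ g : G, v ∈ (T (vtx K u)).support → g • u = v := by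
    intro v
    by_cases hv : v ∈ (T (vtx K u)).support
    · obtain ⟨g, hg⟩ := htrans u v (hT.obSetoid_of_apply_ne_zero (Finsupp.mem_support_iff.1 hv))
      exact ⟨g, fun _ => hg⟩
    -- A dummy value: only vertices in the support are used.
    · exact ⟨1, fun h => absurd h hv⟩
  choose g hg using h
  refine ⟨∑ v ∈ (T (vtx K u)).support, MonoidAlgebra.single (g v) (T (vtx K u) v), ?_⟩
  -- Both sides are equivariant, so it suffices that they agree at `u`.
  refine sub_eq_zero.1 (((isEquivariant_groupAlgebraHom hpath _).sub hT).eq_zero (u := u) ?_)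
  rw [LinearMap.sub_apply, sub_eq_zero, map_sum, LinearMap.sum_apply]
  conv_rhs => rw [← Finsupp.sum_single (T (vtx K u))]
  refine Finset.sum_congr rfl fun v hv => ?_
  rw [groupAlgebraHom_single, LinearMap.smul_apply, permRep_vtx, hg v hv,
    Finsupp.smul_single_one]

/-- If a group acts freely on `Δ` over `Λ` such that the classes of `∼` are contained in the orbits,
then `V_(Δ,α)` is indecomposable if and only if the group algebra has no nontrivial idempotents. -/
theorem isIndecomposableModule_iff
    (htrans : ∀ v w : X.graph.Ob, X.obSetoid v w → ∃ g : G, g • v = w)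
    (hfree : ∀ (g : G) (v : X.graph.Ob), g • v = v → g = 1)
    (hpath : ∀ (g : G) (f : X.graph.Path), ∃ f' : X.graph.Path, f'.left = g • f.left ∧
      f'.right = g • f.right ∧ X.hom.onPath f' = X.hom.onPath f) :
    IsIndecomposableModule (X.action K) ↔ HasNoNontrivialIdempotents (MonoidAlgebra K G) := by
  have hinj := groupAlgebraHom_injective (K := K) hfree
  constructor
  · rintro ⟨-, h⟩ e he
    have hP : IsIdempotentElem (X.groupAlgebraHom K e) := he.map _
    have hc := (isEquivariant_groupAlgebraHom (K := K) hpath e).commute_action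
    have hc' : ∀ a x, X.action K a (X.groupAlgebraHom K e x) =
        X.groupAlgebraHom K e (X.action K a x) :=
      fun a x => (LinearMap.congr_fun (hc a).eq x).symm
    have hker : ∀ a, ∀ x ∈ (X.groupAlgebraHom K e).ker,
        X.action K a x ∈ (X.groupAlgebraHom K e).ker := by
      intro a x hx
      rw [LinearMap.mem_ker] at hx ⊢
      rw [← hc', hx, map_zero]
    have hrange : ∀ a, ∀ x ∈ (X.groupAlgebraHom K e).range,
        X.action K a x ∈ (X.groupAlgebraHom K e).range := by
      rintro a _ ⟨x, rfl⟩
      exact ⟨X.action K a x, (hc' a x).symm⟩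
    -- Zero range means that the projection is `0`. Zero kernel, applied to `P (P x) = P x`, means
    -- that it is `1`.
    obtain h0 | h0 := h _ _ hrange hker (LinearMap.IsIdempotentElem.isCompl hP)
    · exact Or.inl (hinj ((LinearMap.range_eq_bot.1 h0).trans (map_zero _).symm))
    · refine Or.inr (hinj ?_)
      rw [map_one]
      exact LinearMap.ext fun x => LinearMap.ker_eq_bot.1 h0 (LinearMap.congr_fun hP.eq x)
  · intro h
    refine ⟨?_, fun U W hU hW hUW => ?_⟩
    · obtain ⟨v⟩ := X.graph.connected.is_nonempty
      exact ⟨vtx K v, 0, by simp⟩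
    -- The projection onto `U` along `W` is equivariant because both submodules are stable. It
    -- therefore comes from an element of the group algebra, idempotent by injectivity.
    · have hc : ∀ a, Commute (U.projection W hUW) (X.action K a) := by
        intro a
        refine LinearMap.ext fun x => ?_
        rw [Module.End.mul_apply, Module.End.mul_apply]
        conv_lhs => rw [← Submodule.projection_add_projection_eq_self hUW x, map_add, map_add]
        rw [Submodule.projection_apply_of_mem_left hUW (hU a _ (Submodule.projection_apply_mem _ _)),
          (Submodule.projection_apply_eq_zero_iff hUW).2
            (hW a _ (Submodule.projection_apply_mem _ _)), add_zero]
      obtain ⟨e, he⟩ := (IsEquivariant.of_commute_action hc).exists_groupAlgebraHom_eq htrans hpath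
      have hid : IsIdempotentElem e := hinj (by
        rw [map_mul, he]
        exact Submodule.isIdempotentElem_projection hUW)
      obtain rfl | rfl := h e hid
      · left
        rw [← Submodule.range_projection hUW, ← he, map_zero, LinearMap.range_zero]
      · right
        rw [← Submodule.ker_projection hUW, ← he, map_one]
        exact LinearMap.ker_id

end groupAction

end RepKGraph

end

theorem theorem5p9 {K : Type*} [Field K] {k : ℕ} (hk : 0 < k) (Λ : KGraph.{u} k)
    (C : CategoryTheory.ConnectedComponents (RepKGraph Λ)) (X : C.Component)
    (Ω : KGraph.{u} k) (τ : KGraph.Hom Ω X.obj.graph) (hτ : KGraph.IsUniversalCovering τ)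
    (Ω_C Γ_C : RepKGraph Λ) (hΩ : Ω_C = X.obj.ofCovering τ hτ.1) (hΓ : Γ_C = Ω_C.quotient)
    (y : Γ_C.graph.Ob) :
    IsIndecomposableModule (Ω_C.action K) ↔
      HasNoNontrivialIdempotents (MonoidAlgebra K (Γ_C.graph.FundamentalGroup y)) := by
  subst hΩ hΓ
  obtain ⟨t, ht⟩ := RepKGraph.exists_trivialisation hτ y
  obtain ⟨_, htrans, hfree, hpath⟩ :=
    (X.obj.ofCovering τ hτ.1).isCovering_quotientProj.exists_mulAction t ht
  refine RepKGraph.isIndecomposableModule_iff (fun v w h => htrans v w ?_) hfree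
    fun g f => ?_
  · exact (X.obj.ofCovering τ hτ.1).qOb_eq.2 h
  · obtain ⟨f', h1, h2, h3⟩ := hpath g f
    -- Paths with the same image in the quotient have the same image in `Λ`.
    exact ⟨f', h1, h2, (RepKGraph.quotientProj_onPath_eq h3).2⟩
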